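/- **Language.** Types of probabilistic PCF are $\sigma,\tau ::= \mathsf{nat} \mid \sigma\Rightarrow\tau$. Terms (up to renaming of bound variables) are $M,N,\dots ::= \underline n \mid x \mid \mathsf{succ}(M) \mid \mathsf{if}(M,P,z\cdot R) \mid \lambda x^\sigma M \mid (M)N \mid \mathsf{dice}(p) \mid \mathsf{fix}(M)$, with $n\in\mathbb N$ and $p\in[0,1]\cap\mathbb Q$. A judgment $\Gamma\vdash M:\sigma$ is derived by the usual rules: $\underline n$ and $\mathsf{dice}(p)$ have type $\mathsf{nat}$; $\mathsf{succ}(M):\mathsf{nat}$ if $M:\mathsf{nat}$; $\Gamma\vdash\mathsf{if}(M,P,z\cdot R):\sigma$ if $\Gamma\vdash M:\mathsf{nat}$, $\Gamma\vdash P:\sigma$ and $\Gamma,z:\mathsf{nat}\vdash R:\sigma$; $\Gamma\vdash\mathsf{fix}(M):\sigma$ if $\Gamma\vdash M:\sigma\Rightarrow\sigma$; and the standard rules for variables, abstraction and application. Let $\Lambda^\Gamma_\sigma$ be the set of terms $M$ with $\Gamma\vdash M:\sigma$. **Reduction.** $M\to_p M'$ ("$M$ reduces in one step to $M'$ with probability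 $p$") is generated by: $(\lambda x^\sigma M)N\to_1 M[N/x]$; $\mathsf{fix}(M)\to_1 (M)\mathsf{fix}(M)$; $\mathsf{succ}(\underline n)\to_1\underline{n+1}$; $\mathsf{if}(\underline 0,P,z\cdot R)\to_1 P$; $\mathsf{if}(\underline{n+1},P,z\cdot R)\to_1 R[\underline n/z]$; $\mathsf{dice}(p)\to_p\underline 0$; $\mathsf{dice}(p)\to_{1-p}\underline 1$; and, if $M\to_p M'$, then $(M)N\to_p(M')N$, $\mathsf{succ}(M)\to_p\mathsf{succ}(M')$ and $\mathsf{if}(M,P,z\cdot R)\to_p\mathsf{if}(M',P,z\cdot R)$. A term is weak-normal if it does not reduce. Let $\mathsf{Red}^{\Gamma,\sigma}$ be the matrix indexed by $\Lambda^\Gamma_\sigma\times\Lambda^\Gamma_\sigma$ with $\mathsf{Red}_{M,M'}=p$ if $M\to_pM'$, $\mathsf{Red}_{M,M'}=1$ if $M$ is weak-normal and $M'=M$, and $\mathsf{Red}_{M,M'}=0$ otherwise. For a square matrix $S$ with nonnegative coefficients, $S^\infty_{i,j}=\sup_k (S^k)_{i,j}$ if $S_{j,j}=1$, and $S^\infty_{i,j}=0$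 otherwise; so, for $M'$ weak-normal, $\mathsf{Red}^\infty_{M,M'}$ is the probability that $M$ reduces to $M'$. **Model.** For vectors $u,u'$ with nonnegative coefficients indexed by a countable set $I$ put $\langle u,u'\rangle=\sum_{a\in I} u_au'_a$, and $\mathcal X^\perp=\{u'\mid\forall u\in\mathcal X\ \langle u,u'\rangle\le1\}$. A probabilistic coherence space $X$ is a countable set $|X|$ (its web) with a set $\mathsf PX$ of vectors indexed by $|X|$ such that $\mathsf PX^{\perp\perp}=\mathsf PX$ and, for each $a\in|X|$, $u_a>0$ for some $u\in\mathsf PX$ and $\{u_a\mid u\in\mathsf PX\}$ is bounded. The space $\mathsf N$ has web $\mathbb N$ and $\mathsf P\mathsf N=\{u\mid\sum_nu_n\le1\}$; write $\overline n\in\mathsf P\mathsf N$ for the vector with $\overline n_k=\delta_{n,k}$. The space $X\mathbin\& Y$ has as web the disjoint union of the webs and as vectors the pairs of a vector of $X$ and one of $Y$; $\top$ has the empty web. For a finite multiset $\mu$ on $|X|$ put $u^\mu=\prod_au_a^{\mu(a)}$ and $u^!=(u^\mu)_\mu$; $!X$ has as web the set of finite multisets on $|X|$ and $\mathsf P(!X)=\{u^!\mid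 u\in\mathsf PX\}^{\perp\perp}$. A matrix $s$ indexed by $|X|\times|Y|$ is in $\mathsf P(X\multimap Y)$ iff $s\cdot u\in\mathsf PY$ for all $u\in\mathsf PX$, where $(s\cdot u)_b=\sum_as_{a,b}u_a$. Put $X\Rightarrow Y={!X}\multimap Y$; each $s\in\mathsf P(X\Rightarrow Y)$ is determined by the function $\hat s:\mathsf PX\to\mathsf PY$, $\hat s(u)=s\cdot u^!$. **Interpretation.** $[\![\mathsf{nat}]\!]=\mathsf N$, $[\![\sigma\Rightarrow\tau]\!]=[\![\sigma]\!]\Rightarrow[\![\tau]\!]$, and $[\![\Gamma]\!]=[\![\sigma_1]\!]\mathbin\&\cdots\mathbin\&[\![\sigma_k]\!]$ for $\Gamma=(x_1:\sigma_1,\dots,x_k:\sigma_k)$ (it is $\top$ if $k=0$). If $\Gamma\vdash M:\sigma$, then $[\![M]\!]_\Gamma\in\mathsf P([\![\Gamma]\!]\Rightarrow[\![\sigma]\!])$ is the matrix whose function $f_M$ is given, by induction on $M$, for $\vec u=(u_1,\dots,u_k)$ with $u_i\in\mathsf P[\![\sigma_i]\!]$, by: $f_{x_i}(\vec u)=u_i$;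 $f_{\underline n}(\vec u)=\overline n$; $f_{\mathsf{dice}(p)}(\vec u)=p\,\overline 0+(1-p)\,\overline 1$; $f_{\mathsf{succ}(P)}(\vec u)=\sum_nf_P(\vec u)_n\,\overline{n+1}$; $f_{\mathsf{if}(P,Q,z\cdot R)}(\vec u)=f_P(\vec u)_0\,f_Q(\vec u)+\sum_nf_P(\vec u)_{n+1}\,f_R(\vec u,\overline n)$; $f_{(P)Q}(\vec u)=\widehat{f_P(\vec u)}(f_Q(\vec u))$; $f_{\lambda x^\sigma P}(\vec u)$ is the matrix whose function is $u\mapsto f_P(\vec u,u)$; and $f_{\mathsf{fix}(P)}(\vec u)=\sup_ng^n(0)$ where $g=\widehat{f_P(\vec u)}$. For $M$ closed, $[\![M]\!]$ is identified with a vector of $\mathsf P[\![\sigma]\!]$. **Theorem.** (1) If $\Gamma\vdash M:\sigma$, then, as matrices, $$[\![M]\!]_\Gamma=\sum_{M'\in\Lambda^\Gamma_\sigma}\mathsf{Red}^{\Gamma,\sigma}_{M,M'}\,[\![M']\!]_\Gamma .$$ (2) If $\vdash M:\mathsf{nat}$, then for all $n\in\mathbb N$, $$\mathsf{Red}^\infty_{M,\underline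 n}\le[\![M]\!]_n,$$ that is, the probability that $M$ reduces to $\underline n$ is at most the $n$-th coefficient of $[\![M]\!]$. -/

import Mathlib

open scoped ENNReal NNReal

namespace PPCF

/-! ## Syntax of probabilistic PCF -/

/-- Types: the ground type of natural numbers and function types. -/
inductive Ty : Type
  | nat : Ty
  | arrow : Ty → Ty → Ty

/-- Typing contexts; variables are de Bruijn indices, and `σ :: Γ` is the context `Γ, x : σ`. -/
abbrev Ctx : Type := List Ty

/-- `Var Γ σ` is the type of the variables declared with type `σ` in `Γ`. -/
inductive Var : Ctx → Ty → Type
  | zero {Γ : Ctx} {σ : Ty} : Var (σ :: Γ) σ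
  | succ {Γ : Ctx} {σ τ : Ty} : Var Γ σ → Var (τ :: Γ) σ

/-- `Term Γ σ` is the set of all terms `M` (up to renaming of bound variables) such that
`Γ ⊢ M : σ`. Each constructor is one typing rule. As abstractions carry the type of their bound
variable, a term has at most one typing derivation in a given context, so that nothing is added
to the terms by having them carry their derivation. -/
inductive Term : Ctx → Ty → Type
  | num {Γ : Ctx} (n : ℕ) : Term Γ Ty.nat
  | var {Γ : Ctx} {σ : Ty} (x : Var Γ σ) : Term Γ σ
  | succ {Γ : Ctx} (M : Term Γ Ty.nat) : Term Γ Ty.nat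
  /-- `ifz M P R` is `if(M, P, z · R)`; the variable `z : nat` is bound in `R`. -/
  | ifz {Γ : Ctx} {σ : Ty} (M : Term Γ Ty.nat) (P : Term Γ σ) (R : Term (Ty.nat :: Γ) σ) :
      Term Γ σ
  | lam {Γ : Ctx} {σ τ : Ty} (M : Term (σ :: Γ) τ) : Term Γ (Ty.arrow σ τ)
  | app {Γ : Ctx} {σ τ : Ty} (M : Term Γ (Ty.arrow σ τ)) (N : Term Γ σ) : Term Γ τ
  | dice {Γ : Ctx} (p : Set.Icc (0 : ℚ) 1) : Term Γ Ty.nat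
  | fix {Γ : Ctx} {σ : Ty} (M : Term Γ (Ty.arrow σ σ)) : Term Γ σ

/-- Renamings of variables. -/
def Ren (Γ Δ : Ctx) : Type := ∀ τ : Ty, Var Γ τ → Var Δ τ

/-- Extension of a renaming under a binder. -/
def Ren.lift {Γ Δ : Ctx} (ρ : Ren Γ Δ) (σ : Ty) : Ren (σ :: Γ) (σ :: Δ)
  | _, Var.zero => Var.zero
  | _, Var.succ x => Var.succ (ρ _ x)

/-- Application of a renaming to a term. -/
def Term.rename : {Γ : Ctx} → {σ : Ty} → Term Γ σ → {Δ : Ctx} → Ren Γ Δ → Term Δ σ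
  | _, _, .num n, _, _ => .num n
  | _, _, .var x, _, ρ => .var (ρ _ x)
  | _, _, .succ M, _, ρ => .succ (M.rename ρ)
  | _, _, .ifz M P R, _, ρ => .ifz (M.rename ρ) (P.rename ρ) (R.rename (ρ.lift _))
  | _, _, .lam M, _, ρ => .lam (M.rename (ρ.lift _))
  | _, _, .app M N, _, ρ => .app (M.rename ρ) (N.rename ρ)
  | _, _, .dice p, _, _ => .dice p
  | _, _, .fix M, _, ρ => .fix (M.rename ρ)

/-- Weakening by one variable. -/
def Term.weaken {Γ : Ctx} {σ : Ty} (τ : Ty) (M : Term Γ σ) : Term (τ :: Γ) σ :=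
  M.rename fun _ x => Var.succ x

/-- Simultaneous substitutions of terms for variables. -/
def Sub (Γ Δ : Ctx) : Type := ∀ τ : Ty, Var Γ τ → Term Δ τ

/-- Extension of a substitution under a binder. -/
def Sub.lift {Γ Δ : Ctx} (θ : Sub Γ Δ) (σ : Ty) : Sub (σ :: Γ) (σ :: Δ)
  | _, Var.zero => Term.var Var.zero
  | _, Var.succ x => (θ _ x).weaken σ

/-- Application of a (capture-avoiding) substitution to a term. -/
def Term.subst : {Γ : Ctx} → {σ : Ty} → Term Γ σ → {Δ : Ctx} → Sub Γ Δ → Term Δ σ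
  | _, _, .num n, _, _ => .num n
  | _, _, .var x, _, θ => θ _ x
  | _, _, .succ M, _, θ => .succ (M.subst θ)
  | _, _, .ifz M P R, _, θ => .ifz (M.subst θ) (P.subst θ) (R.subst (θ.lift _))
  | _, _, .lam M, _, θ => .lam (M.subst (θ.lift _))
  | _, _, .app M N, _, θ => .app (M.subst θ) (N.subst θ)
  | _, _, .dice p, _, _ => .dice p
  | _, _, .fix M, _, θ => .fix (M.subst θ)

/-- The substitution `x ↦ N` that leaves the variables of `Γ` unchanged. -/
def Sub.single {Γ : Ctx} {σ : Ty} (N : Term Γ σ) : Sub (σ :: Γ) Γ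
  | _, Var.zero => N
  | _, Var.succ x => Term.var x

/-- `M[N / x]`, where `x` is the last variable of the context of `M`. -/
def Term.subst1 {Γ : Ctx} {σ τ : Ty} (M : Term (σ :: Γ) τ) (N : Term Γ σ) : Term Γ τ :=
  M.subst (Sub.single N)

/-! ## Weak-head reduction and its stochastic matrix -/

/-- Deterministic reduction. -/
inductive DStep : {Γ : Ctx} → {σ : Ty} → Term Γ σ → Term Γ σ → Prop
  | beta {Γ : Ctx} {σ τ : Ty} (M : Term (σ :: Γ) τ) (N : Term Γ σ) :
      DStep (.app (.lam M) N) (M.subst1 N)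
  | fix {Γ : Ctx} {σ : Ty} (M : Term Γ (Ty.arrow σ σ)) : DStep (.fix M) (.app M (.fix M))
  | succ {Γ : Ctx} (n : ℕ) : DStep (.succ (.num n) : Term Γ Ty.nat) (.num (n + 1))
  | ifzZero {Γ : Ctx} {σ : Ty} (P : Term Γ σ) (R : Term (Ty.nat :: Γ) σ) :
      DStep (.ifz (.num 0) P R) P
  | ifzSucc {Γ : Ctx} {σ : Ty} (n : ℕ) (P : Term Γ σ) (R : Term (Ty.nat :: Γ) σ) :
      DStep (.ifz (.num (n + 1)) P R) (R.subst1 (.num n))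

/-- `Step M p M'`: the term `M` reduces in one step to `M'` with probability `p`. -/
inductive Step : {Γ : Ctx} → {σ : Ty} → Term Γ σ → ℝ → Term Γ σ → Prop
  | det {Γ : Ctx} {σ : Ty} {M M' : Term Γ σ} : DStep M M' → Step M 1 M'
  | diceZero {Γ : Ctx} (p : Set.Icc (0 : ℚ) 1) :
      Step (.dice p : Term Γ Ty.nat) ((p : ℚ) : ℝ) (.num 0)
  | diceOne {Γ : Ctx} (p : Set.Icc (0 : ℚ) 1) :
      Step (.dice p : Term Γ Ty.nat) (1 - ((p : ℚ) : ℝ)) (.num 1)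
  | app {Γ : Ctx} {σ τ : Ty} {M M' : Term Γ (Ty.arrow σ τ)} {p : ℝ} (N : Term Γ σ) :
      Step M p M' → Step (.app M N) p (.app M' N)
  | succ {Γ : Ctx} {M M' : Term Γ Ty.nat} {p : ℝ} :
      Step M p M' → Step (.succ M) p (.succ M')
  | ifz {Γ : Ctx} {σ : Ty} {M M' : Term Γ Ty.nat} {p : ℝ} (P : Term Γ σ)
      (R : Term (Ty.nat :: Γ) σ) : Step M p M' → Step (.ifz M P R) p (.ifz M' P R)

/-- Weak-normal terms. -/
def WeakNormal {Γ : Ctx} {σ : Ty} (M : Term Γ σ) : Prop := ∀ p M', ¬ Step M p M'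

theorem Step.eq_one_of_dstep {Γ : Ctx} {σ : Ty} {M N N' : Term Γ σ} {q : ℝ}
    (h : DStep M N) (h' : Step M q N') : q = 1 := by
  cases h with
  | beta M N =>
    cases h' with
    | det => rfl
    | app _ h => cases h with | det h => cases h
  | fix M =>
    cases h' with
    | det => rfl
  | succ n =>
    cases h' with
    | det => rfl
    | succ h => cases h with | det h => cases h
  | ifzZero P R =>
    cases h' with
    | det => rfl
    | ifz _ _ h => cases h with | det h => cases h
  | ifzSucc n P R =>
    cases h' with
    | det => rfl
    | ifz _ _ h => cases h with | det h => cases h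

/-- The probability of a one-step reduction `M → M'` is determined by `M` and `M'`. -/
theorem Step.prob_unique {Γ : Ctx} {σ : Ty} {M M' : Term Γ σ} {p q : ℝ}
    (h : Step M p M') (h' : Step M q M') : p = q := by
  induction h generalizing q with
  | det h => exact (Step.eq_one_of_dstep h h').symm
  | diceZero p =>
    cases h' with
    | det h => cases h
    | diceZero => rfl
  | diceOne p =>
    cases h' with
    | det h => cases h
    | diceOne => rfl
  | app N h ih =>
    generalize hN : Term.app _ N = K at h'
    cases h' with
    | det h2 => exact Step.eq_one_of_dstep (hN ▸ h2) (.app N h)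
    | app _ h2 => cases hN; exact ih h2
  | succ h ih =>
    generalize hN : Term.succ _ = K at h'
    cases h' with
    | det h2 => exact Step.eq_one_of_dstep (hN ▸ h2) (.succ h)
    | succ h2 => cases hN; exact ih h2
  | ifz P R h ih =>
    generalize hN : Term.ifz _ P R = K at h'
    cases h' with
    | det h2 => exact Step.eq_one_of_dstep (hN ▸ h2) (.ifz P R h)
    | ifz _ _ h2 => cases hN; exact ih h2

noncomputable section

open Classical in
/-- The matrix of one-step reduction, indexed by the terms of type `σ` in context `Γ`: the
coefficient at `(M, M')` is `p` if `M` reduces in one step to `M'` with probability `p`, it is `1`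
if `M` is weak-normal and `M' = M`, and `0` otherwise. -/
def redMat {Γ : Ctx} {σ : Ty} (M M' : Term Γ σ) : ℝ≥0∞ :=
  if h : ∃ p : ℝ, Step M p M' then ENNReal.ofReal h.choose
  else if WeakNormal M ∧ M' = M then 1
  else 0

/-- Product of two square matrices with nonnegative coefficients. -/
def matMul {I : Type} (S T : I → I → ℝ≥0∞) : I → I → ℝ≥0∞ :=
  fun i j => ∑' k, S i k * T k j

open Classical in
/-- Powers of a square matrix with nonnegative coefficients. -/
def matPow {I : Type} (S : I → I → ℝ≥0∞) : ℕ → I → I → ℝ≥0∞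
  | 0 => fun i j => if i = j then 1 else 0
  | n + 1 => matMul (matPow S n) S

open Classical in
/-- The matrix `S^∞`: if the state `j` is stationary (that is `S j j = 1`), then its coefficient
at `(i, j)` is the supremum of the coefficients of the powers of `S`; otherwise it is `0`. -/
def matLim {I : Type} (S : I → I → ℝ≥0∞) : I → I → ℝ≥0∞ :=
  fun i j => if S j j = 1 then ⨆ n, matPow S n i j else 0

/-! ## Probabilistic coherence spaces -/

/-- The pairing `⟨u, u'⟩ = ∑ u_a u'_a`. -/
def pairing {I : Type} (u u' : I → ℝ≥0∞) : ℝ≥0∞ := ∑' a, u a * u' a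

/-- The orthogonal of a set of vectors. -/
def orth {I : Type} (G : Set (I → ℝ≥0∞)) : Set (I → ℝ≥0∞) :=
  {u' | ∀ u ∈ G, pairing u u' ≤ 1}

theorem pairing_comm {I : Type} (u v : I → ℝ≥0∞) : pairing u v = pairing v u := by
  simp only [pairing, mul_comm]

theorem orth_anti {I : Type} {G H : Set (I → ℝ≥0∞)} (h : G ⊆ H) : orth H ⊆ orth G :=
  fun _ hu v hv => hu v (h hv)

theorem subset_biorth {I : Type} (G : Set (I → ℝ≥0∞)) : G ⊆ orth (orth G) :=
  fun u hu v hv => by rw [pairing_comm]; exact hv u hu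

theorem triorth {I : Type} (G : Set (I → ℝ≥0∞)) : orth (orth (orth G)) = orth G :=
  Set.Subset.antisymm (orth_anti (subset_biorth G)) (subset_biorth (orth G))

/-- A probabilistic coherence space with (countable) web `I`. The condition `bdd` forces the
coefficients of the elements of `P` to be finite, and `pos` forces those of the elements of
`orth P` to be finite, so that it makes no difference whether vectors are taken with coefficients
in `[0, ∞)` or in `[0, ∞]`. -/
structure PCS (I : Type) [Countable I] where
  /-- The clique set of the space, the set of its vectors. -/
  P : Set (I → ℝ≥0∞)
  biorth : orth (orth P) = P
  pos : ∀ a, ∃ u ∈ P, 0 < u a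
  bdd : ∀ a, ∃ A : ℝ≥0, 0 < A ∧ ∀ u ∈ P, u a ≤ A

theorem PCS.lt_top {I : Type} [Countable I] (X : PCS I) {u : I → ℝ≥0∞} (hu : u ∈ X.P) (a : I) :
    u a < ∞ := by
  obtain ⟨A, -, hA⟩ := X.bdd a
  exact lt_of_le_of_lt (hA u hu) ENNReal.coe_lt_top

open Classical in
theorem pairing_single {I : Type} (u : I → ℝ≥0∞) (a : I) (c : ℝ≥0∞) :
    pairing u (Pi.single a c) = u a * c := by
  rw [pairing, tsum_eq_single a]
  · simp
  · intro b hb; simp [hb]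

open Classical in
theorem single_mem_orth {I : Type} {G : Set (I → ℝ≥0∞)} {a : I} {A : ℝ≥0}
    (h : ∀ u ∈ G, u a ≤ A) : (Pi.single a (A : ℝ≥0∞)⁻¹ : I → ℝ≥0∞) ∈ orth G := by
  intro u hu
  rw [pairing_single, ← div_eq_mul_inv]
  exact ENNReal.div_le_of_le_mul (by simpa using h u hu)

theorem bdd_orth {I : Type} {G : Set (I → ℝ≥0∞)} {a : I} (h : ∃ u ∈ G, 0 < u a) :
    ∃ A : ℝ≥0, 0 < A ∧ ∀ u' ∈ orth G, u' a ≤ A := by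
  obtain ⟨u, hu, hpos⟩ := h
  have key : ∀ u' ∈ orth G, u' a ≤ (u a)⁻¹ := by
    intro u' hu'
    rw [ENNReal.le_inv_iff_mul_le, mul_comm]
    exact (ENNReal.le_tsum a).trans (hu' u hu)
  have hfin : (u a)⁻¹ ≠ ∞ := ENNReal.inv_ne_top.2 hpos.ne'
  refine ⟨(u a)⁻¹.toNNReal + 1, by positivity, fun u' hu' => (key u' hu').trans ?_⟩
  rw [ENNReal.coe_add, ENNReal.coe_toNNReal hfin]
  exact le_self_add

open Classical in
theorem pos_orth {I : Type} {G : Set (I → ℝ≥0∞)} {a : I}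
    (h : ∃ A : ℝ≥0, 0 < A ∧ ∀ u ∈ G, u a ≤ A) : ∃ u' ∈ orth G, 0 < u' a := by
  obtain ⟨A, hA, h⟩ := h
  exact ⟨_, single_mem_orth h, by simp⟩

/-- The dual space. -/
def PCS.dual {I : Type} [Countable I] (X : PCS I) : PCS I where
  P := orth X.P
  biorth := triorth X.P
  pos a := pos_orth (X.bdd a)
  bdd a := bdd_orth (X.pos a)

/-- The space whose vectors are the biorthogonal of a set `G`. -/
def PCS.gen {I : Type} [Countable I] (G : Set (I → ℝ≥0∞)) (pos : ∀ a, ∃ u ∈ G, 0 < u a)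
    (bdd : ∀ a, ∃ A : ℝ≥0, 0 < A ∧ ∀ u ∈ G, u a ≤ A) : PCS I where
  P := orth (orth G)
  biorth := triorth (orth G)
  pos a := by
    obtain ⟨u, hu, h⟩ := pos a
    exact ⟨u, subset_biorth G hu, h⟩
  bdd a := bdd_orth (pos_orth (bdd a))

/-- The tensor product of two spaces. -/
def PCS.tensor {I J : Type} [Countable I] [Countable J] (X : PCS I) (Y : PCS J) : PCS (I × J) :=
  PCS.gen {w | ∃ u ∈ X.P, ∃ v ∈ Y.P, w = fun x => u x.1 * v x.2}
    (by
      rintro ⟨a, b⟩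
      obtain ⟨u, hu, hua⟩ := X.pos a
      obtain ⟨v, hv, hvb⟩ := Y.pos b
      exact ⟨_, ⟨u, hu, v, hv, rfl⟩, ENNReal.mul_pos hua.ne' hvb.ne'⟩)
    (by
      rintro ⟨a, b⟩
      obtain ⟨A, hA, hXA⟩ := X.bdd a
      obtain ⟨B, hB, hYB⟩ := Y.bdd b
      refine ⟨A * B, mul_pos hA hB, ?_⟩
      rintro _ ⟨u, hu, v, hv, rfl⟩
      rw [ENNReal.coe_mul]
      exact mul_le_mul' (hXA u hu) (hYB v hv))

/-- The space of linear morphisms, `X ⊸ Y = (X ⊗ Y^⊥)^⊥`. -/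
def PCS.limp {I J : Type} [Countable I] [Countable J] (X : PCS I) (Y : PCS J) : PCS (I × J) :=
  (X.tensor Y.dual).dual

/-- A matrix is a linear morphism if and only if it maps the vectors of `X` to vectors of `Y`. -/
theorem PCS.mem_limp {I J : Type} [Countable I] [Countable J] {X : PCS I} {Y : PCS J}
    {t : I × J → ℝ≥0∞} :
    t ∈ (X.limp Y).P ↔ ∀ u ∈ X.P, (fun b => ∑' a, t (a, b) * u a) ∈ Y.P := by
  have key : ∀ (u : I → ℝ≥0∞) (v : J → ℝ≥0∞),
      pairing (fun x : I × J => u x.1 * v x.2) t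
        = pairing v (fun b => ∑' a, t (a, b) * u a) := by
    intro u v
    rw [pairing, ENNReal.tsum_prod', ENNReal.tsum_comm, pairing]
    refine tsum_congr fun b => ?_
    rw [← ENNReal.tsum_mul_left]
    exact tsum_congr fun a => by ring
  have e : (X.limp Y).P
      = orth {w | ∃ u ∈ X.P, ∃ v ∈ Y.dual.P, w = fun x => u x.1 * v x.2} := triorth _
  rw [e]
  constructor
  · intro h u hu
    rw [← Y.biorth]
    intro v hv
    rw [← key]
    exact h _ ⟨u, hu, v, hv, rfl⟩
  · rintro h _ ⟨u, hu, v, hv, rfl⟩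
    rw [key, pairing_comm]
    exact hv _ (h u hu)

/-- The unit of the cartesian product: the space with empty web. -/
def PCS.top : PCS Empty where
  P := Set.univ
  biorth := Set.eq_univ_of_forall fun u v _ => by simp [pairing]
  pos a := a.elim
  bdd a := a.elim

theorem PCS.zero_mem {I : Type} [Countable I] (X : PCS I) : (fun _ => 0) ∈ X.P := by
  rw [← X.biorth]
  intro v _
  simp [pairing]

/-- The cartesian product of two spaces. -/
def PCS.prod {I J : Type} [Countable I] [Countable J] (X : PCS I) (Y : PCS J) : PCS (I ⊕ J) where
  P := {u | (fun a => u (Sum.inl a)) ∈ X.P ∧ (fun b => u (Sum.inr b)) ∈ Y.P}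
  biorth := by
    refine Set.Subset.antisymm (fun w hw => ⟨?_, ?_⟩) (subset_biorth _)
    · rw [← X.biorth]
      intro u' hu'
      have := hw (Sum.elim u' fun _ => 0) (by
        rintro u ⟨hu, -⟩
        simpa [pairing, ENNReal.summable.tsum_sum] using hu' _ hu)
      simpa [pairing, ENNReal.summable.tsum_sum] using this
    · rw [← Y.biorth]
      intro u' hu'
      have := hw (Sum.elim (fun _ => 0) u') (by
        rintro u ⟨-, hu⟩
        simpa [pairing, ENNReal.summable.tsum_sum] using hu' _ hu)
      simpa [pairing, ENNReal.summable.tsum_sum] using this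
  pos := by
    rintro (a | b)
    · obtain ⟨u, hu, h⟩ := X.pos a
      exact ⟨Sum.elim u fun _ => 0, ⟨by simpa using hu, by simpa using Y.zero_mem⟩, by simpa⟩
    · obtain ⟨u, hu, h⟩ := Y.pos b
      exact ⟨Sum.elim (fun _ => 0) u, ⟨by simpa using X.zero_mem, by simpa using hu⟩, by simpa⟩
  bdd := by
    rintro (a | b)
    · obtain ⟨A, hA, h⟩ := X.bdd a
      exact ⟨A, hA, fun u hu => h _ hu.1⟩
    · obtain ⟨A, hA, h⟩ := Y.bdd b
      exact ⟨A, hA, fun u hu => h _ hu.2⟩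

/-- The space of natural numbers: its vectors are the subprobability distributions on `ℕ`. -/
def PCS.nat : PCS ℕ where
  P := {u | ∑' n, u n ≤ 1}
  biorth := by
    refine Set.Subset.antisymm (fun w hw => ?_) (subset_biorth _)
    have := hw (fun _ => 1) (fun u hu => by simpa [pairing] using hu)
    simpa [pairing] using this
  pos a := ⟨Pi.single a 1, by simp [tsum_pi_single], by simp⟩
  bdd a := ⟨1, one_pos, fun u hu => (ENNReal.le_tsum a).trans (by simpa using hu)⟩

/-- The vector `u^! = (u^μ)_μ`, indexed by finite multisets `μ` (functions with finite support to
the natural numbers), where `u^μ = ∏ u_a ^ μ(a)`. -/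
def promVec {I : Type} (u : I → ℝ≥0∞) (μ : I →₀ ℕ) : ℝ≥0∞ := μ.prod fun a k => u a ^ k

theorem pairing_add {I : Type} (c : ℝ≥0∞) (u v w : I → ℝ≥0∞) :
    pairing (fun a => c * u a + c * v a) w = c * pairing u w + c * pairing v w := by
  simp only [pairing, add_mul, ENNReal.tsum_add, mul_assoc, ENNReal.tsum_mul_left]

theorem PCS.exists_pos_finset {I : Type} [Countable I] (X : PCS I) (s : Finset I) :
    ∃ u ∈ X.P, ∀ a ∈ s, 0 < u a := by
  classical
  induction s using Finset.induction_on with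
  | empty => exact ⟨_, X.zero_mem, by simp⟩
  | insert b s _ ih =>
    obtain ⟨u, hu, hus⟩ := ih
    obtain ⟨v, hv, hvb⟩ := X.pos b
    refine ⟨fun a => 2⁻¹ * u a + 2⁻¹ * v a, ?_, ?_⟩
    · rw [← X.biorth] at hu hv ⊢
      intro w hw
      rw [pairing_comm, pairing_add]
      calc _ ≤ (2⁻¹ : ℝ≥0∞) * 1 + 2⁻¹ * 1 := by
            gcongr
            · rw [pairing_comm]; exact hu w hw
            · rw [pairing_comm]; exact hv w hw
        _ = 1 := by simp [ENNReal.inv_two_add_inv_two]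
    · intro a ha
      rcases Finset.mem_insert.1 ha with rfl | ha
      · exact lt_of_lt_of_le (ENNReal.mul_pos (by simp) hvb.ne') le_add_self
      · exact lt_of_lt_of_le (ENNReal.mul_pos (by simp) (hus a ha).ne') le_self_add

/-- The exponential `!X`, whose web is the set of finite multisets of elements of the web of `X`
and whose set of vectors is the biorthogonal of `{u^! | u ∈ P X}`. -/
def PCS.bang {I : Type} [Countable I] (X : PCS I) : PCS (I →₀ ℕ) :=
  PCS.gen {w | ∃ u ∈ X.P, w = promVec u}
    (by
      intro μ
      obtain ⟨u, hu, hpos⟩ := X.exists_pos_finset μ.support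
      refine ⟨_, ⟨u, hu, rfl⟩, ?_⟩
      rw [promVec, Finsupp.prod, pos_iff_ne_zero, Finset.prod_ne_zero_iff]
      exact fun a ha => pow_ne_zero _ (hpos a ha).ne')
    (by
      intro μ
      choose A hA hXA using X.bdd
      refine ⟨μ.prod fun a k => A a ^ k, Finset.prod_pos fun a _ => pow_pos (hA a) _, ?_⟩
      rintro _ ⟨u, hu, rfl⟩
      simp only [promVec, Finsupp.prod, ENNReal.ofNNReal_finsetProd, ENNReal.coe_pow]
      exact Finset.prod_le_prod' fun a _ => pow_le_pow_left' (hXA a u hu) _)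

/-- The object of morphisms of the Kleisli category, `X ⇒ Y = !X ⊸ Y`. Its vectors are the
morphisms from `X` to `Y` in the Kleisli category of the exponential comonad. -/
def PCS.impl {I J : Type} [Countable I] [Countable J] (X : PCS I) (Y : PCS J) :
    PCS ((I →₀ ℕ) × J) :=
  X.bang.limp Y

/-! ## Kleisli morphisms as families of power series

A matrix `s` indexed by `(I →₀ ℕ) × J` is the same thing as a family `(s_b)` of formal power series
indexed by `b : J`, in the variables `a : I` and with coefficients in `[0, ∞]`: the coefficient of
`s_b` at the monomial `μ` is `s (μ, b)`. The product of power series implements contraction. -/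

/-- Families of power series. -/
abbrev Mat (I J : Type) : Type := J → MvPowerSeries I ℝ≥0∞

/-- The matrix of a family of power series. -/
def Mat.toVec {I J : Type} (s : Mat I J) : (I →₀ ℕ) × J → ℝ≥0∞ :=
  fun x => MvPowerSeries.coeff x.1 (s x.2)

/-- The value of a power series at a vector `u`. -/
def value {I : Type} (u : I → ℝ≥0∞) (s : MvPowerSeries I ℝ≥0∞) : ℝ≥0∞ :=
  ∑' μ, MvPowerSeries.coeff μ s * promVec u μ

/-- The function `u ↦ s · u^!` associated with a matrix. -/
def Mat.toFun {I J : Type} (s : Mat I J) (u : I → ℝ≥0∞) : J → ℝ≥0∞ := fun b => value u (s b)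

theorem promVec_zero {I : Type} (u : I → ℝ≥0∞) : promVec u 0 = 1 := Finsupp.prod_zero_index

theorem promVec_add {I : Type} (u : I → ℝ≥0∞) (μ ν : I →₀ ℕ) :
    promVec u (μ + ν) = promVec u μ * promVec u ν := by
  classical
  exact Finsupp.prod_add_index' (fun _ => pow_zero _) (fun _ _ _ => pow_add _ _ _)

theorem promVec_single {I : Type} (u : I → ℝ≥0∞) (a : I) (k : ℕ) :
    promVec u (Finsupp.single a k) = u a ^ k := Finsupp.prod_single_index (pow_zero _)

theorem promVec_sumElim {I J : Type} (u : I ⊕ J → ℝ≥0∞) (μ : I →₀ ℕ) (ν : J →₀ ℕ) :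
    promVec u (Finsupp.sumElim μ ν)
      = promVec (fun a => u (Sum.inl a)) μ * promVec (fun b => u (Sum.inr b)) ν := by
  rw [promVec, Finsupp.prod_sumElim]; rfl

theorem value_C {I : Type} (u : I → ℝ≥0∞) (c : ℝ≥0∞) : value u (MvPowerSeries.C c) = c := by
  classical
  rw [value, tsum_eq_single 0]
  · simp [promVec_zero]
  · intro μ hμ; simp [MvPowerSeries.coeff_C, hμ]

theorem value_X {I : Type} (u : I → ℝ≥0∞) (a : I) : value u (MvPowerSeries.X a) = u a := by
  classical
  rw [value, tsum_eq_single (Finsupp.single a 1)]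
  · simp [promVec_single]
  · intro μ hμ; simp [MvPowerSeries.coeff_X, hμ]

theorem value_add {I : Type} (u : I → ℝ≥0∞) (s t : MvPowerSeries I ℝ≥0∞) :
    value u (s + t) = value u s + value u t := by
  simp only [value, map_add, add_mul, ENNReal.tsum_add]

theorem value_mul {I : Type} (u : I → ℝ≥0∞) (s t : MvPowerSeries I ℝ≥0∞) :
    value u (s * t) = value u s * value u t := by
  classical
  calc value u (s * t)
      = ∑' μ, ∑ x ∈ Finset.HasAntidiagonal.antidiagonal μ,
          (MvPowerSeries.coeff x.1 s * promVec u x.1)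
            * (MvPowerSeries.coeff x.2 t * promVec u x.2) := by
        refine tsum_congr fun μ => ?_
        rw [MvPowerSeries.coeff_mul, Finset.sum_mul]
        refine Finset.sum_congr rfl fun x hx => ?_
        have hx' : x.1 + x.2 = μ := by simpa using hx
        rw [← hx', promVec_add]
        ring
    _ = ∑' x : (I →₀ ℕ) × (I →₀ ℕ),
          (MvPowerSeries.coeff x.1 s * promVec u x.1)
            * (MvPowerSeries.coeff x.2 t * promVec u x.2) := by
        rw [← (Finset.HasAntidiagonal.sigmaAntidiagonalEquivProd (A := I →₀ ℕ)).tsum_eq, ENNReal.tsum_sigma']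
        refine tsum_congr fun μ => ?_
        rw [tsum_fintype, Finset.univ_eq_attach]
        exact (Finset.sum_attach _ _).symm
    _ = value u s * value u t := by
        rw [ENNReal.tsum_prod', value, value, ← ENNReal.tsum_mul_right]
        exact tsum_congr fun μ => by simp only [ENNReal.tsum_mul_left]

theorem value_pow {I : Type} (u : I → ℝ≥0∞) (s : MvPowerSeries I ℝ≥0∞) (k : ℕ) :
    value u (s ^ k) = value u s ^ k := by
  induction k with
  | zero => rw [pow_zero, pow_zero, ← map_one MvPowerSeries.C, value_C]
  | succ k ih => rw [pow_succ, pow_succ, value_mul, ih]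

theorem Mat.toVec_mem_impl {I J : Type} [Countable I] [Countable J] {X : PCS I} {Y : PCS J}
    {s : Mat I J} (h : ∀ u ∈ X.P, s.toFun u ∈ Y.P) : s.toVec ∈ (X.impl Y).P := by
  refine PCS.mem_limp.2 ?_
  have key : ∀ (w : (I →₀ ℕ) → ℝ≥0∞) (v : J → ℝ≥0∞),
      pairing v (fun b => ∑' a, s.toVec (a, b) * w a)
        = pairing w (fun a => ∑' b, s.toVec (a, b) * v b) := by
    intro w v
    simp only [pairing, ← ENNReal.tsum_mul_left]
    rw [ENNReal.tsum_comm]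
    exact tsum_congr fun a => tsum_congr fun b => by ring
  intro w hw
  rw [← Y.biorth]
  intro v hv
  rw [key, pairing_comm]
  refine hw _ ?_
  rintro _ ⟨u, hu, rfl⟩
  rw [← key, pairing_comm]
  exact hv _ (h u hu)

/-- The promotion `f^!` of a Kleisli morphism `f`: its coefficient at `(μ, [b_1, …, b_n])` is the
sum, over all families `(μ_1, …, μ_n)` with `μ_1 + ⋯ + μ_n = μ`, of the products of the
coefficients of `f` at the `(μ_i, b_i)`. It is characterized by `f^! · u^! = (f · u^!)^!`. -/
def Mat.prom {I J : Type} (f : Mat I J) : Mat I (J →₀ ℕ) := fun ν => ν.prod fun b k => f b ^ k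

theorem Mat.toFun_prom {I J : Type} (f : Mat I J) (u : I → ℝ≥0∞) :
    f.prom.toFun u = promVec (f.toFun u) := by
  funext ν
  simp only [Mat.toFun, Mat.prom, promVec, Finsupp.prod]
  induction ν.support using Finset.cons_induction with
  | empty => simp only [Finset.prod_empty]; rw [← map_one MvPowerSeries.C, value_C]
  | cons a s ha ih => simp only [Finset.prod_cons, value_mul, value_pow, ih]

/-- Composition `t ∘ f` of a matrix `t` with a Kleisli morphism. -/
def Mat.linComp {I J K : Type} (t : J × K → ℝ≥0∞) (f : Mat I J) : Mat I K :=
  fun c μ => ∑' b, t (b, c) * MvPowerSeries.coeff μ (f b)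

theorem Mat.toFun_linComp {I J K : Type} (t : J × K → ℝ≥0∞) (f : Mat I J) (u : I → ℝ≥0∞) :
    (Mat.linComp t f).toFun u = fun c => ∑' b, t (b, c) * f.toFun u b := by
  funext c
  simp only [Mat.toFun, value, ← ENNReal.tsum_mul_left]
  rw [ENNReal.tsum_comm]
  refine tsum_congr fun μ => ?_
  simp only [← mul_assoc, ENNReal.tsum_mul_right]
  rfl

/-- Composition `g ∘ f = g · f^!` in the Kleisli category. -/
def Mat.comp {I J K : Type} (g : Mat J K) (f : Mat I J) : Mat I K := Mat.linComp g.toVec f.prom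

theorem Mat.toFun_comp {I J K : Type} (g : Mat J K) (f : Mat I J) (u : I → ℝ≥0∞) :
    (g.comp f).toFun u = g.toFun (f.toFun u) := by
  rw [Mat.comp, Mat.toFun_linComp, Mat.toFun_prom]
  rfl

/-- The value at `v` of the power series whose matrix is `w`; that is, `w` seen as a function. -/
def applyVec {I J : Type} (w : (I →₀ ℕ) × J → ℝ≥0∞) (v : I → ℝ≥0∞) : J → ℝ≥0∞ :=
  fun b => ∑' ν, w (ν, b) * promVec v ν

/-- Application of `f : Z → (X ⇒ Y)` to `g : Z → X`: the composition of the evaluation morphism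
`(X ⇒ Y) ⊗ !X ⊸ Y` with `f ⊗ g^!` and with contraction. -/
def Mat.app {I J K : Type} (f : Mat I ((J →₀ ℕ) × K)) (g : Mat I J) : Mat I K :=
  fun c μ => ∑' ν, MvPowerSeries.coeff μ (f (ν, c) * g.prom ν)

theorem Mat.toFun_app {I J K : Type} (f : Mat I ((J →₀ ℕ) × K)) (g : Mat I J) (u : I → ℝ≥0∞) :
    (Mat.app f g).toFun u = applyVec (f.toFun u) (g.toFun u) := by
  funext c
  have h : ∀ ν, value u (f (ν, c) * g.prom ν) = f.toFun u (ν, c) * promVec (g.toFun u) ν := by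
    intro ν
    rw [value_mul, ← Mat.toFun_prom]; rfl
  simp only [applyVec, ← h, value]
  rw [ENNReal.tsum_comm]
  refine tsum_congr fun μ => ?_
  rw [ENNReal.tsum_mul_right]
  rfl

/-- Currying: `f : X & Y → Z` is turned into a morphism `X → (Y ⇒ Z)`. -/
def Mat.curry {I J K : Type} (f : Mat (I ⊕ J) K) : Mat I ((J →₀ ℕ) × K) :=
  fun x μ => MvPowerSeries.coeff (Finsupp.sumElim μ x.1) (f x.2)

theorem Mat.applyVec_toFun_curry {I J K : Type} (f : Mat (I ⊕ J) K) (u : I → ℝ≥0∞)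
    (v : J → ℝ≥0∞) : applyVec (f.curry.toFun u) v = f.toFun (Sum.elim u v) := by
  funext c
  simp only [applyVec, Mat.toFun, value, ← ENNReal.tsum_mul_right]
  rw [ENNReal.tsum_comm, ← ENNReal.tsum_prod,
    ← (Finsupp.sumFinsuppEquivProdFinsupp (α := I) (β := J) (γ := ℕ)).symm.tsum_eq]
  refine tsum_congr fun x => ?_
  have e : Finsupp.sumFinsuppEquivProdFinsupp.symm x = Finsupp.sumElim x.1 x.2 := rfl
  rw [e, promVec_sumElim, ← mul_assoc]
  rfl

open Classical in
/-- The coalgebra structure `ℕ ⊸ !ℕ` of the space of natural numbers: its coefficient at `(n, ν)`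
is `1` if `ν = k [n]` for some `k`, and `0` otherwise. -/
def natAlg (n : ℕ) (ν : ℕ →₀ ℕ) : ℝ≥0∞ := if ∃ k, ν = Finsupp.single n k then 1 else 0

/-- The vector of `P ℕ` that represents the number `n`. -/
def numVec (n k : ℕ) : ℝ≥0∞ := if k = n then 1 else 0

theorem natAlg_eq (n : ℕ) (ν : ℕ →₀ ℕ) : natAlg n ν = promVec (numVec n) ν := by
  rw [natAlg]
  split_ifs with h
  · obtain ⟨k, rfl⟩ := h
    simp [promVec_single, numVec]
  · symm
    rw [promVec, Finsupp.prod, Finset.prod_eq_zero_iff]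
    by_contra hc
    push Not at hc
    refine h ⟨ν n, ?_⟩
    ext k
    by_cases hk : k = n
    · subst hk; simp
    · rw [Finsupp.single_apply, if_neg (Ne.symm hk)]
      by_contra hν
      refine hc k (Finsupp.mem_support_iff.2 hν) ?_
      rw [numVec, if_neg hk, zero_pow hν]

/-- The matrix of the successor function. -/
def sucMat (x : ℕ × ℕ) : ℝ≥0∞ := if x.2 = x.1 + 1 then 1 else 0

/-- The application of `h : Z → (ℕ ⇒ X)` to the number `n`, through the coalgebra structure. -/
def Mat.appNum {I J : Type} (h : Mat I ((ℕ →₀ ℕ) × J)) (n : ℕ) : Mat I J :=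
  fun b μ => ∑' ν, natAlg n ν * MvPowerSeries.coeff μ (h (ν, b))

theorem Mat.toFun_appNum {I J : Type} (h : Mat I ((ℕ →₀ ℕ) × J)) (n : ℕ) (u : I → ℝ≥0∞) :
    (h.appNum n).toFun u = applyVec (h.toFun u) (numVec n) := by
  funext b
  simp only [applyVec, Mat.toFun, value, ← natAlg_eq, ← ENNReal.tsum_mul_right]
  rw [ENNReal.tsum_comm]
  refine tsum_congr fun μ => ?_
  have e : MvPowerSeries.coeff μ (h.appNum n b)
    = ∑' ν, natAlg n ν * MvPowerSeries.coeff μ (h (ν, b)) := rfl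
  rw [e, ← ENNReal.tsum_mul_right]
  exact tsum_congr fun ν => by ring

/-- The conditional: the composition of the morphism `if : ℕ ⊗ !X ⊗ !(ℕ ⇒ X) ⊸ X` with
`f ⊗ g^! ⊗ h^!` and with contraction. -/
def Mat.cond {I J : Type} (f : Mat I ℕ) (g : Mat I J) (h : Mat I ((ℕ →₀ ℕ) × J)) : Mat I J :=
  fun b μ => MvPowerSeries.coeff μ (f 0 * g b)
    + ∑' n, MvPowerSeries.coeff μ (f (n + 1) * h.appNum n b)

theorem Mat.toFun_cond {I J : Type} (f : Mat I ℕ) (g : Mat I J) (h : Mat I ((ℕ →₀ ℕ) × J))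
    (u : I → ℝ≥0∞) : (Mat.cond f g h).toFun u = fun b => f.toFun u 0 * g.toFun u b
      + ∑' n, f.toFun u (n + 1) * applyVec (h.toFun u) (numVec n) b := by
  funext b
  have e : ∀ n, f.toFun u (n + 1) * applyVec (h.toFun u) (numVec n) b
      = value u (f (n + 1) * h.appNum n b) := by
    intro n
    rw [value_mul, ← Mat.toFun_appNum]; rfl
  have e0 : f.toFun u 0 * g.toFun u b = value u (f 0 * g b) := by rw [value_mul]; rfl
  simp only [e, e0, value]
  rw [ENNReal.tsum_comm, ← ENNReal.tsum_add]
  refine tsum_congr fun μ => ?_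
  rw [ENNReal.tsum_mul_right, ← add_mul]
  rfl

/-- The morphism `Fix_n : (X ⇒ X) → X` given by `Fix_0 = 0` and `Fix_{n+1} = Ev ∘ ⟨Id, Fix_n⟩`. -/
def fixApprox (I : Type) : ℕ → Mat ((I →₀ ℕ) × I) I
  | 0 => fun _ => 0
  | n + 1 => Mat.app (fun x => MvPowerSeries.X x) (fixApprox I n)

/-- The least fixpoint operator `Fix : (X ⇒ X) → X`, the supremum of the morphisms `Fix_n`. -/
def fixMat (I : Type) : Mat ((I →₀ ℕ) × I) I :=
  fun a μ => ⨆ n, MvPowerSeries.coeff μ (fixApprox I n a)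

theorem coeff_mul_mono {I : Type} {s s' t t' : MvPowerSeries I ℝ≥0∞}
    (hs : ∀ μ, MvPowerSeries.coeff μ s ≤ MvPowerSeries.coeff μ s')
    (ht : ∀ μ, MvPowerSeries.coeff μ t ≤ MvPowerSeries.coeff μ t') (μ : I →₀ ℕ) :
    MvPowerSeries.coeff μ (s * t) ≤ MvPowerSeries.coeff μ (s' * t') := by
  classical
  simp only [MvPowerSeries.coeff_mul]
  exact Finset.sum_le_sum fun x _ => mul_le_mul' (hs _) (ht _)

theorem coeff_prom_mono {I J : Type} {f g : Mat I J}
    (h : ∀ b μ, MvPowerSeries.coeff μ (f b) ≤ MvPowerSeries.coeff μ (g b)) (ν : J →₀ ℕ) :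
    ∀ μ, MvPowerSeries.coeff μ (f.prom ν) ≤ MvPowerSeries.coeff μ (g.prom ν) := by
  have hp : ∀ b k μ, MvPowerSeries.coeff μ (f b ^ k) ≤ MvPowerSeries.coeff μ (g b ^ k) := by
    intro b k
    induction k with
    | zero => intro μ; simp only [pow_zero, le_refl]
    | succ k ih => intro μ; simp only [pow_succ]; exact coeff_mul_mono ih (h b) μ
  simp only [Mat.prom, Finsupp.prod]
  induction ν.support using Finset.cons_induction with
  | empty => intro μ; simp only [Finset.prod_empty, le_refl]
  | cons a s ha ih => intro μ; simp only [Finset.prod_cons]; exact coeff_mul_mono (hp _ _) ih μ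

theorem fixApprox_mono (I : Type) (a : I) (μ : (I →₀ ℕ) × I →₀ ℕ) :
    Monotone fun n => MvPowerSeries.coeff μ (fixApprox I n a) := by
  refine monotone_nat_of_le_succ fun n => ?_
  induction n generalizing a μ with
  | zero => simp [fixApprox]
  | succ n ih =>
    exact ENNReal.tsum_le_tsum fun ν =>
      coeff_mul_mono (fun _ => le_rfl) (coeff_prom_mono (fun b μ => ih b μ) ν) μ

theorem tsum_iSup_of_monotone {α : Type} (f : ℕ → α → ℝ≥0∞) (h : ∀ a, Monotone fun n => f n a) :
    ∑' a, ⨆ n, f n a = ⨆ n, ∑' a, f n a := by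
  let _ : MeasurableSpace α := ⊤
  simp only [← MeasureTheory.lintegral_count]
  exact MeasureTheory.lintegral_iSup (fun _ => measurable_from_top) fun m n hmn a => h a hmn

theorem toFun_fixMat {I : Type} (w : (I →₀ ℕ) × I → ℝ≥0∞) :
    (fixMat I).toFun w = fun a => ⨆ n, (fixApprox I n).toFun w a := by
  funext a
  simp only [Mat.toFun, value]
  rw [← tsum_iSup_of_monotone]
  · refine tsum_congr fun μ => ?_
    rw [← ENNReal.iSup_mul]
    rfl
  · exact fun μ m n hmn => mul_le_mul_left (fixApprox_mono I a μ hmn) _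

theorem toFun_fixApprox_succ {I : Type} (w : (I →₀ ℕ) × I → ℝ≥0∞) (n : ℕ) :
    (fixApprox I (n + 1)).toFun w = applyVec w ((fixApprox I n).toFun w) := by
  rw [fixApprox, Mat.toFun_app]
  congr 1
  funext x
  exact value_X w x

theorem PCS.applyVec_mem {I J : Type} [Countable I] [Countable J] {X : PCS I} {Y : PCS J}
    {w : (I →₀ ℕ) × J → ℝ≥0∞} (hw : w ∈ (X.impl Y).P) {v : I → ℝ≥0∞} (hv : v ∈ X.P) :
    applyVec w v ∈ Y.P :=
  PCS.mem_limp.1 hw _ (subset_biorth _ ⟨v, hv, rfl⟩)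

/-- A vector is in `P (X ⇒ Y)` if it maps `P X` to `P Y`. -/
theorem PCS.mem_impl {I J : Type} [Countable I] [Countable J] {X : PCS I} {Y : PCS J}
    {w : (I →₀ ℕ) × J → ℝ≥0∞} (h : ∀ v ∈ X.P, applyVec w v ∈ Y.P) : w ∈ (X.impl Y).P :=
  Mat.toVec_mem_impl (s := fun b μ => w (μ, b)) h

theorem PCS.iSup_mem {I : Type} [Countable I] (X : PCS I) (u : ℕ → I → ℝ≥0∞)
    (h : ∀ a, Monotone fun n => u n a) (hu : ∀ n, u n ∈ X.P) : (fun a => ⨆ n, u n a) ∈ X.P := by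
  rw [← X.biorth]
  intro v hv
  simp only [pairing, ENNReal.mul_iSup]
  rw [tsum_iSup_of_monotone]
  · refine iSup_le fun n => ?_
    rw [← X.biorth] at hu
    exact hu n v hv
  · exact fun a m n hmn => mul_le_mul_right (h a hmn) _

theorem toFun_fixMat_mem {I : Type} [Countable I] {X : PCS I} {w : (I →₀ ℕ) × I → ℝ≥0∞}
    (hw : w ∈ (X.impl X).P) : (fixMat I).toFun w ∈ X.P := by
  rw [toFun_fixMat]
  refine X.iSup_mem _ (fun a m n hmn => ?_) fun n => ?_
  · exact ENNReal.tsum_le_tsum fun μ => mul_le_mul_left (fixApprox_mono I a μ hmn) _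
  · induction n with
    | zero =>
      convert X.zero_mem using 1
      funext a
      simp [Mat.toFun, value, fixApprox]
    | succ n ih =>
      rw [toFun_fixApprox_succ]
      exact PCS.applyVec_mem hw ih

theorem cond_mem {J : Type} [Countable J] {Y : PCS J} {u : ℕ → ℝ≥0∞} (hu : u ∈ PCS.nat.P)
    {v : J → ℝ≥0∞} (hv : v ∈ Y.P) {w : ℕ → J → ℝ≥0∞} (hw : ∀ n, w n ∈ Y.P) :
    (fun b => u 0 * v b + ∑' n, u (n + 1) * w n b) ∈ Y.P := by
  rw [← Y.biorth] at hv hw ⊢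
  intro v' hv'
  have e : pairing v' (fun b => u 0 * v b + ∑' n, u (n + 1) * w n b)
      = u 0 * pairing v' v + ∑' n, u (n + 1) * pairing v' (w n) := by
    simp only [pairing, mul_add, ENNReal.tsum_add, ← ENNReal.tsum_mul_left]
    congr 1
    · exact tsum_congr fun a => by ring
    · rw [ENNReal.tsum_comm]
      exact tsum_congr fun n => tsum_congr fun a => by ring
  rw [e]
  calc u 0 * pairing v' v + ∑' n, u (n + 1) * pairing v' (w n)
      ≤ u 0 * 1 + ∑' n, u (n + 1) * 1 :=
        add_le_add (mul_le_mul_right (hv v' hv') _)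
          (ENNReal.tsum_le_tsum fun n => mul_le_mul_right (hw n v' hv') _)
    _ = ∑' n, u n := by
        simp only [mul_one]
        exact (tsum_eq_zero_add' ENNReal.summable).symm
    _ ≤ 1 := hu

/-! ## Interpretation of types and terms -/

/-- The web of the interpretation of a type. -/
@[reducible] def Ty.Web : Ty → Type
  | .nat => ℕ
  | .arrow σ τ => (σ.Web →₀ ℕ) × τ.Web

instance Ty.countable_web : (σ : Ty) → Countable σ.Web
  | .nat => inferInstanceAs (Countable ℕ)
  | .arrow σ τ =>
    haveI := Ty.countable_web σ
    haveI := Ty.countable_web τ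
    inferInstanceAs (Countable ((σ.Web →₀ ℕ) × τ.Web))

/-- The interpretation of a type. -/
def Ty.sem : (σ : Ty) → PCS σ.Web
  | .nat => PCS.nat
  | .arrow σ τ => σ.sem.impl τ.sem

/-- The web of the interpretation of a context. -/
@[reducible] def CtxWeb : Ctx → Type
  | [] => Empty
  | σ :: Γ => CtxWeb Γ ⊕ σ.Web

instance CtxWeb.countable : (Γ : Ctx) → Countable (CtxWeb Γ)
  | [] => inferInstanceAs (Countable Empty)
  | σ :: Γ =>
    haveI := CtxWeb.countable Γ
    inferInstanceAs (Countable (CtxWeb Γ ⊕ σ.Web))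

/-- The interpretation of a context, the cartesian product of the interpretations of its types. -/
def ctxSem : (Γ : Ctx) → PCS (CtxWeb Γ)
  | [] => PCS.top
  | σ :: Γ => (ctxSem Γ).prod σ.sem

/-- The inclusion of the web of the type of a variable into the web of the context. -/
def Var.inj : {Γ : Ctx} → {σ : Ty} → Var Γ σ → σ.Web → CtxWeb Γ
  | _, _, .zero => fun a => Sum.inr a
  | _, _, .succ x => fun a => Sum.inl (x.inj a)

/-- The interpretation of a term, as a family of power series. -/
def Term.mat : {Γ : Ctx} → {σ : Ty} → Term Γ σ → Mat (CtxWeb Γ) σ.Web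
  | _, _, .num n => fun k => MvPowerSeries.C (numVec n k)
  | _, _, .var x => fun a => MvPowerSeries.X (x.inj a)
  | _, _, .succ M => Mat.linComp sucMat M.mat
  | _, _, .ifz M P R => Mat.cond M.mat P.mat (Mat.curry R.mat)
  | _, _, .lam M => Mat.curry M.mat
  | _, _, .app M N => Mat.app M.mat N.mat
  | _, _, .dice p => fun k => MvPowerSeries.C
      (ENNReal.ofReal ((p : ℚ) : ℝ) * numVec 0 k + ENNReal.ofReal (1 - ((p : ℚ) : ℝ)) * numVec 1 k)
  | _, _, .fix M => Mat.comp (fixMat _) M.mat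

theorem numVec_mem (n : ℕ) : numVec n ∈ PCS.nat.P := by
  simp [PCS.nat, numVec]

theorem Var.inj_mem {Γ : Ctx} {σ : Ty} (x : Var Γ σ) {u : CtxWeb Γ → ℝ≥0∞}
    (hu : u ∈ (ctxSem Γ).P) : (fun a => u (x.inj a)) ∈ σ.sem.P := by
  induction x with
  | zero => exact hu.2
  | succ x ih => exact ih hu.1

theorem Term.toFun_mat_mem {Γ : Ctx} {σ : Ty} (M : Term Γ σ) :
    ∀ u ∈ (ctxSem Γ).P, M.mat.toFun u ∈ σ.sem.P := by
  induction M with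
  | num n =>
    intro u hu
    have e : (Term.mat (.num n)).toFun u = numVec n := funext fun k => value_C _ _
    rw [e]; exact numVec_mem n
  | var x =>
    intro u hu
    have e : (Term.mat (.var x)).toFun u = fun a => u (x.inj a) := funext fun k => value_X _ _
    rw [e]; exact x.inj_mem hu
  | succ M ih =>
    intro u hu
    have e : (Term.mat (.succ M)).toFun u = _ := Mat.toFun_linComp _ _ _
    rw [e]
    have h := ih u hu
    change ∑' c : ℕ, ∑' b : ℕ, sucMat (b, c) * M.mat.toFun u b ≤ 1
    rw [ENNReal.tsum_comm]
    refine le_trans (le_of_eq (tsum_congr fun b => ?_)) h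
    rw [ENNReal.tsum_mul_right]
    simp [sucMat]
  | ifz M P R ihM ihP ihR =>
    intro u hu
    have e : (Term.mat (.ifz M P R)).toFun u = _ := Mat.toFun_cond _ _ _ _
    rw [e]
    refine cond_mem (ihM u hu) (ihP u hu) fun n => ?_
    rw [Mat.applyVec_toFun_curry]
    exact ihR _ ⟨hu, numVec_mem n⟩
  | lam M ih =>
    intro u hu
    refine PCS.mem_impl fun v hv => ?_
    have e : applyVec ((Term.mat (.lam M)).toFun u) v = _ := Mat.applyVec_toFun_curry M.mat u v
    rw [e]
    exact ih _ ⟨hu, hv⟩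
  | app M N ihM ihN =>
    intro u hu
    have e : (Term.mat (.app M N)).toFun u = _ := Mat.toFun_app _ _ _
    rw [e]
    exact PCS.applyVec_mem (ihM u hu) (ihN u hu)
  | dice p =>
    intro u hu
    have e : (Term.mat (.dice p)).toFun u = fun k => ENNReal.ofReal ((p : ℚ) : ℝ) * numVec 0 k
        + ENNReal.ofReal (1 - ((p : ℚ) : ℝ)) * numVec 1 k := funext fun k => value_C _ _
    rw [e]
    change ∑' k : ℕ, _ ≤ (1 : ℝ≥0∞)
    have h0 : (0 : ℝ) ≤ ((p : ℚ) : ℝ) := by exact_mod_cast p.2.1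
    have h1 : ((p : ℚ) : ℝ) ≤ 1 := by exact_mod_cast p.2.2
    rw [ENNReal.tsum_add, ENNReal.tsum_mul_left, ENNReal.tsum_mul_left]
    simp only [numVec, tsum_ite_eq, mul_one]
    rw [← ENNReal.ofReal_add h0 (by linarith)]
    simp
  | fix M ih =>
    intro u hu
    have e : (Term.mat (.fix M)).toFun u = _ := Mat.toFun_comp _ _ _
    rw [e]
    exact toFun_fixMat_mem (ih u hu)

/-- The interpretation of a term `M` such that `Γ ⊢ M : σ`: a morphism from the interpretation of
`Γ` to that of `σ` in the Kleisli category, that is, an element of `P (!Γ ⊸ σ)`. -/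
def Term.sem {Γ : Ctx} {σ : Ty} (M : Term Γ σ) :
    {s : (CtxWeb Γ →₀ ℕ) × σ.Web → ℝ≥0∞ // s ∈ ((ctxSem Γ).impl σ.sem).P} :=
  ⟨M.mat.toVec, Mat.toVec_mem_impl M.toFun_mat_mem⟩

/-- The interpretation of a closed term `M` as a vector of the interpretation of its type. -/
def Term.closedSem {σ : Ty} (M : Term [] σ) : σ.Web → ℝ≥0∞ := fun a => M.sem.1 (0, a)

end

end PPCF

namespace PPCF

/-! ## Uniqueness of coefficients -/

/-! Reduction is weak-head: it acts only in function position, under `succ`, or in the scrutinee of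
a conditional, and in each of these places the denotation of the whole term is linear in that of the
subterm. Hence, at a fixed environment in `P⟦Γ⟧`, an invariance equation for a subterm passes to the
whole term by exchanging sums. The base rules remain: beta is the substitution lemma `toFun_subst`,
unfolding of `fix` is the fixpoint equation `applyVec_toFun_fixMat` (from Scott continuity), and the
other rules are computations with numerals. This yields `toFun_eq_tsum`.

That is an equality of functions, whereas (1) is one of matrices. The bridge is
`PCS.eq_of_value_eq`: a power series with nonnegative coefficients and finite values on `P X` is
determined by those values. It is also needed inside the substitution lemma, because the value of an
abstraction is a matrix known only through its function (`PCS.impl_ext`). Its proof reduces to one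
variable, where coefficients are compared by letting the variable tend to `0`, and then fixes the
degrees in the finitely many variables of a monomial.

For (2), equation (1) says that the vector of closed interpretations is fixed by `Red`, hence by
every power `Red^k`. In the resulting sum for the `n`-th coefficient, keeping only the term `num n`,
whose coefficient there is `1`, bounds each `(Red^k)` entry and so their supremum. -/

/-- Cancel the common terms of degree below `n`, divide by `t ^ n` and let `t` tend to `0`. Stating
an inequality, to be used in both directions, avoids subtraction in `ℝ≥0∞`. -/
theorem coeff_le_of_tsum_pow_eq {a b : ℕ → ℝ≥0∞} (ha : ∑' n, a n ≠ ∞)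
    (h : ∀ t : ℝ≥0∞, t ≤ 1 → ∑' n, a n * t ^ n = ∑' n, b n * t ^ n) (n : ℕ)
    (ih : ∀ i < n, a i = b i) : a n ≤ b n := by
  have hb : ∑' n, b n ≠ ∞ := by
    have := h 1 le_rfl
    simp only [one_pow, mul_one] at this
    rwa [← this]
  -- For `t ≤ 1` the terms of degree above `n` contain at least one more factor `t`, so together
  -- they are at most `t * t ^ n * ∑' n, b n`.
  have key : ∀ t : ℝ≥0∞, t ≠ 0 → t ≤ 1 → a n ≤ b n + t * ∑' n, b n := by
    intro t ht0 ht1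
    have htop : t ≠ ∞ := (ht1.trans_lt ENNReal.one_lt_top).ne
    have e := h t ht1
    rw [← ENNReal.summable.sum_add_tsum_nat_add' (f := fun n => a n * t ^ n) (k := n),
      ← ENNReal.summable.sum_add_tsum_nat_add' (f := fun n => b n * t ^ n) (k := n),
      Finset.sum_congr rfl fun i hi => by rw [ih i (Finset.mem_range.1 hi)]] at e
    have hfin : ∑ i ∈ Finset.range n, b i * t ^ i ≠ ∞ := by
      refine ENNReal.sum_ne_top.2 fun i _ => ENNReal.mul_ne_top ?_ (ENNReal.pow_ne_top htop)
      exact ne_top_of_le_ne_top hb (ENNReal.le_tsum i)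
    have e' := (ENNReal.add_right_inj hfin).1 e
    have hp0 : t ^ n ≠ 0 := pow_ne_zero _ ht0
    have hpt : t ^ n ≠ ∞ := ENNReal.pow_ne_top htop
    have h1 : a n * t ^ n ≤ (b n + t * ∑' n, b n) * t ^ n := by
      calc a n * t ^ n ≤ ∑' i, a (i + n) * t ^ (i + n) := by
            simpa using ENNReal.le_tsum (f := fun i => a (i + n) * t ^ (i + n)) 0
        _ = b n * t ^ n + ∑' i, b (i + 1 + n) * t ^ (i + 1 + n) := by
            rw [e', tsum_eq_zero_add' ENNReal.summable]
            simp
        _ ≤ b n * t ^ n + ∑' i, b (i + 1 + n) * (t * t ^ n) := by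
            gcongr with i
            rw [← pow_succ']
            exact pow_le_pow_right_of_le_one' ht1 (by omega)
        _ ≤ b n * t ^ n + (∑' i, b i) * (t * t ^ n) := by
            rw [ENNReal.tsum_mul_right]
            refine add_le_add le_rfl (mul_le_mul_left ?_ _)
            exact ENNReal.tsum_comp_le_tsum_of_injective
              (f := fun i : ℕ => i + 1 + n) (fun i j hij => by simpa using hij) b
        _ = _ := by ring
    exact (ENNReal.mul_le_mul_iff_left hp0 hpt).1 h1
  -- Take `t = 1 / (k + 1)`; the error term vanishes in the limit because the sum of `b` is finite.
  have hlim : Filter.Tendsto (fun k : ℕ => b n + ((k : ℝ≥0∞) + 1)⁻¹ * ∑' n, b n) Filter.atTop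
      (nhds (b n + 0 * ∑' n, b n)) := by
    refine Filter.Tendsto.const_add _ (ENNReal.Tendsto.mul_const ?_ (Or.inr hb))
    have := (Filter.tendsto_add_atTop_iff_nat 1).2 ENNReal.tendsto_inv_nat_nhds_zero
    simpa using this
  rw [zero_mul, add_zero] at hlim
  refine ge_of_tendsto' hlim fun k => key _ (by simp) (by simp)

/-- Power series in one variable that converge at `1` are determined by their values. -/
theorem eq_of_tsum_pow_eq {a b : ℕ → ℝ≥0∞} (ha : ∑' n, a n ≠ ∞)
    (h : ∀ t : ℝ≥0∞, t ≤ 1 → ∑' n, a n * t ^ n = ∑' n, b n * t ^ n) : a = b := by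
  have hb : ∑' n, b n ≠ ∞ := by
    have := h 1 le_rfl
    simp only [one_pow, mul_one] at this
    rwa [← this]
  funext n
  induction n using Nat.strong_induction_on with
  | _ n ih =>
    exact le_antisymm (coeff_le_of_tsum_pow_eq ha h n ih)
      (coeff_le_of_tsum_pow_eq hb (fun t ht => (h t ht).symm) n fun i hi => (ih i hi).symm)

/-! ### Power series in several variables -/

-- Setting the coordinate `a` to `1` erases its contribution, so the second factor does not depend
-- on `x a`: a monomial is exhibited as a power of one variable times a constant.
open Classical in
theorem promVec_eq_pow_mul_update {I : Type} (x : I → ℝ≥0∞) (a : I) (ν : I →₀ ℕ) :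
    promVec x ν = x a ^ ν a * promVec (Function.update x a 1) ν := by
  have h : ∀ y : I → ℝ≥0∞, promVec y ν = y a ^ ν a * promVec y (ν.erase a) := by
    intro y
    conv_lhs => rw [← Finsupp.single_add_erase a ν]
    rw [promVec_add, promVec_single]
  rw [h x, h (Function.update x a 1), Function.update_self, one_pow, one_mul]
  congr 1
  refine Finsupp.prod_congr fun b hb => ?_
  rw [Function.update_of_ne]
  rintro rfl
  simp at hb

open Classical in
/-- If two power series have the same values on the unit cube, then so do their parts of degree
`k` in the variable `a`. -/
theorem tsum_restrict_eq {I : Type} {s t : (I →₀ ℕ) → ℝ≥0∞} (hs : ∑' ν, s ν ≠ ∞)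
    (h : ∀ x : I → ℝ≥0∞, (∀ a, x a ≤ 1) → ∑' ν, s ν * promVec x ν = ∑' ν, t ν * promVec x ν)
    (a : I) (k : ℕ) (x : I → ℝ≥0∞) (hx : ∀ a, x a ≤ 1) :
    ∑' ν, (if ν a = k then s ν else 0) * promVec x ν
      = ∑' ν, (if ν a = k then t ν else 0) * promVec x ν := by
  set x' := Function.update x a 1 with hx'
  have hx'1 : ∀ b, x' b ≤ 1 := by
    intro b
    rcases eq_or_ne b a with rfl | hb
    · simp [hx']
    · simpa [hx', Function.update_of_ne hb] using hx b
  -- Grouping the exponents by their degree `n` in `a` turns the values along the line `c ↦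
  -- Function.update x a c` into a power series in the single variable `c`.
  have key : ∀ (r : (I →₀ ℕ) → ℝ≥0∞) (c : ℝ≥0∞),
      ∑' n, (∑' ν, (if ν a = n then r ν else 0) * promVec x' ν) * c ^ n
        = ∑' ν, r ν * promVec (Function.update x a c) ν := by
    intro r c
    simp only [← ENNReal.tsum_mul_right]
    rw [ENNReal.tsum_comm]
    refine tsum_congr fun ν => ?_
    rw [tsum_eq_single (ν a) (fun n hn => by rw [if_neg hn.symm, zero_mul, zero_mul]), if_pos rfl,
      promVec_eq_pow_mul_update (Function.update x a c) a, Function.update_self, Function.update_idem]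
    ring
  have e := eq_of_tsum_pow_eq
    (a := fun n => ∑' ν, (if ν a = n then s ν else 0) * promVec x' ν)
    (b := fun n => ∑' ν, (if ν a = n then t ν else 0) * promVec x' ν)
    (by
      have := key s 1
      simp only [one_pow, mul_one] at this
      rw [this]
      refine ne_top_of_le_ne_top hs (ENNReal.tsum_le_tsum fun ν => mul_le_of_le_one_right' ?_)
      exact Finset.prod_le_one' fun b _ => pow_le_one' (hx'1 b) _)
    (by
      intro c hc
      rw [key, key]
      refine h _ fun b => ?_
      rcases eq_or_ne b a with rfl | hb
      · simpa using hc
      · simpa [Function.update_of_ne hb] using hx b)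
  -- On the part of degree `k` in `a`, passing from `x'` back to `x` only costs the factor `x a ^
  -- k`.
  have e2 : ∀ r : (I →₀ ℕ) → ℝ≥0∞, ∑' ν, (if ν a = k then r ν else 0) * promVec x ν
      = x a ^ k * ∑' ν, (if ν a = k then r ν else 0) * promVec x' ν := by
    intro r
    rw [← ENNReal.tsum_mul_left]
    refine tsum_congr fun ν => ?_
    split_ifs with hk
    · rw [promVec_eq_pow_mul_update x a, hk]; ring
    · simp
  rw [e2, e2]
  exact congrArg (x a ^ k * ·) (congrFun e k)

-- The truncated series still has finite sum and agrees with its counterpart on the cube, so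
-- `tsum_restrict_eq` can be applied again, one variable of `F` at a time.
open Classical in
theorem tsum_restrict_finset_eq {I : Type} {s t : (I →₀ ℕ) → ℝ≥0∞} (hs : ∑' ν, s ν ≠ ∞)
    (h : ∀ x : I → ℝ≥0∞, (∀ a, x a ≤ 1) → ∑' ν, s ν * promVec x ν = ∑' ν, t ν * promVec x ν)
    (μ : I →₀ ℕ) (F : Finset I) : ∀ x : I → ℝ≥0∞, (∀ a, x a ≤ 1) →
    ∑' ν, (if ∀ a ∈ F, ν a = μ a then s ν else 0) * promVec x ν
      = ∑' ν, (if ∀ a ∈ F, ν a = μ a then t ν else 0) * promVec x ν := by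
  induction F using Finset.induction_on with
  | empty => simpa using h
  | insert a F _ ih =>
    intro x hx
    have := tsum_restrict_eq (ne_top_of_le_ne_top hs (ENNReal.tsum_le_tsum fun ν => by
      split_ifs <;> simp)) ih a (μ a) x hx
    simpa only [Finset.forall_mem_insert, ite_and] using this

/-! ### Extensionality on probabilistic coherence spaces -/

theorem PCS.mem_of_le {I : Type} [Countable I] (X : PCS I) {u v : I → ℝ≥0∞} (hu : u ∈ X.P)
    (h : ∀ a, v a ≤ u a) : v ∈ X.P := by
  rw [← X.biorth] at hu ⊢
  exact fun w hw => (ENNReal.tsum_le_tsum fun a => mul_le_mul_right (h a) _).trans (hu w hw)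

theorem promVec_mul {I : Type} (u v : I → ℝ≥0∞) (ν : I →₀ ℕ) :
    promVec (fun a => u a * v a) ν = promVec u ν * promVec v ν := by
  simp only [promVec, Finsupp.prod, mul_pow, Finset.prod_mul_distrib]

/-- A power series is determined by its values on the vectors of a probabilistic coherence space,
if these values are finite. -/
theorem PCS.eq_of_value_eq {I : Type} [Countable I] (X : PCS I) {s t : MvPowerSeries I ℝ≥0∞}
    (hs : ∀ u ∈ X.P, value u s ≠ ∞) (h : ∀ u ∈ X.P, value u s = value u t) : s = t := by
  classical
  ext μ
  obtain ⟨u₀, hu₀, hpos⟩ := X.exists_pos_finset μ.support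
  -- Truncating `u₀` to the support of `μ` kills every monomial that involves another variable, so
  -- an infinite web causes no difficulty.
  set u : I → ℝ≥0∞ := fun a => if a ∈ μ.support then u₀ a else 0 with hudef
  have hu : u ∈ X.P := X.mem_of_le hu₀ fun a => by
    simp only [hudef]; split_ifs <;> simp
  -- Among exponents that agree with `μ` on its support, any other one uses a variable where `u`
  -- vanishes; only `μ` contributes.
  have hsupp : ∀ (r : MvPowerSeries I ℝ≥0∞),
      ∑' ν, (if ∀ a ∈ μ.support, ν a = μ a then MvPowerSeries.coeff ν r * promVec u ν else 0)
        * promVec (fun _ => 1) ν = MvPowerSeries.coeff μ r * promVec u μ := by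
    intro r
    rw [tsum_eq_single μ]
    · simp [promVec, Finsupp.prod]
    · intro ν hν
      split_ifs with hF
      · obtain ⟨a, ha⟩ := Finsupp.ne_iff.1 hν
        have haμ : a ∉ μ.support := fun hc => ha (hF a hc)
        have haν : a ∈ ν.support := by
          rw [Finsupp.notMem_support_iff.1 haμ] at ha
          exact Finsupp.mem_support_iff.2 ha
        have : promVec u ν = 0 := by
          refine Finset.prod_eq_zero haν ?_
          simp only [hudef, if_neg haμ]
          exact zero_pow (Finsupp.mem_support_iff.1 haν)
        rw [this]; simp
      · simp
  -- Absorbing `promVec u` into the coefficients rescales the box below `u`, which lies in `P X`, to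
  -- the unit cube.
  have key := tsum_restrict_finset_eq
    (s := fun ν => MvPowerSeries.coeff ν s * promVec u ν)
    (t := fun ν => MvPowerSeries.coeff ν t * promVec u ν) (hs u hu)
    (by
      intro x hx
      have hxu : (fun a => u a * x a) ∈ X.P := X.mem_of_le hu fun a => mul_le_of_le_one_right' (hx a)
      have := h _ hxu
      simpa only [value, promVec_mul, mul_assoc] using this)
    μ μ.support (fun _ => 1) fun _ => le_rfl
  rw [hsupp, hsupp] at key
  have h0 : promVec u μ ≠ 0 := by
    rw [promVec, Finsupp.prod, Finset.prod_ne_zero_iff]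
    intro a ha
    simp only [hudef, if_pos ha]
    exact pow_ne_zero _ (hpos a ha).ne'
  have ht : promVec u μ ≠ ∞ :=
    ENNReal.prod_ne_top fun a _ => ENNReal.pow_ne_top (X.lt_top hu a).ne
  exact (ENNReal.mul_left_inj h0 ht).1 key

/-- A vector of `X ⇒ Y` is determined by its function. -/
theorem PCS.impl_ext {I J : Type} [Countable I] [Countable J] {X : PCS I} {Y : PCS J}
    {w w' : (I →₀ ℕ) × J → ℝ≥0∞} (hw : w ∈ (X.impl Y).P)
    (h : ∀ v ∈ X.P, applyVec w v = applyVec w' v) : w = w' := by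
  funext ⟨μ, b⟩
  exact congrFun (X.eq_of_value_eq (s := fun μ => w (μ, b)) (t := fun μ => w' (μ, b))
    (fun u hu => (Y.lt_top (PCS.applyVec_mem hw hu) b).ne) fun u hu => congrFun (h u hu) b) μ

end PPCF

namespace PPCF

/-! ## Continuity of application -/

theorem iSup_mul_iSup_of_monotone {f g : ℕ → ℝ≥0∞} (hf : Monotone f) (hg : Monotone g) :
    (⨆ n, f n) * ⨆ n, g n = ⨆ n, f n * g n := by
  refine le_antisymm ?_ (iSup_le fun n => mul_le_mul' (le_iSup f n) (le_iSup g n))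
  rw [ENNReal.iSup_mul]
  refine iSup_le fun i => ?_
  rw [ENNReal.mul_iSup]
  refine iSup_le fun j => le_iSup_of_le (max i j) ?_
  exact mul_le_mul' (hf (le_max_left i j)) (hg (le_max_right i j))

theorem promVec_mono {I : Type} {u v : I → ℝ≥0∞} (h : ∀ a, u a ≤ v a) (ν : I →₀ ℕ) :
    promVec u ν ≤ promVec v ν :=
  Finset.prod_le_prod' fun a _ => pow_le_pow_left' (h a) _

/-- A monomial is a finite product, and products of increasing sequences commute with suprema along
the diagonal. -/
theorem promVec_iSup {I : Type} {u : ℕ → I → ℝ≥0∞} (hu : ∀ a, Monotone fun n => u n a)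
    (ν : I →₀ ℕ) : promVec (fun a => ⨆ n, u n a) ν = ⨆ n, promVec (u n) ν := by
  have hpow : ∀ a k, (⨆ n, u n a) ^ k = ⨆ n, u n a ^ k := by
    intro a k
    induction k with
    | zero => simp
    | succ k ih =>
      simp only [pow_succ]
      rw [ih, iSup_mul_iSup_of_monotone (fun m n hmn => pow_le_pow_left' (hu a hmn) k) (hu a)]
  simp only [promVec, Finsupp.prod]
  induction ν.support using Finset.cons_induction with
  | empty => simp
  | cons a s ha ih =>
    simp only [Finset.prod_cons]
    rw [ih, hpow]
    exact iSup_mul_iSup_of_monotone (fun m n hmn => pow_le_pow_left' (hu a hmn) _)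
      (fun m n hmn => Finset.prod_le_prod' fun b _ => pow_le_pow_left' (hu b hmn) _)

/-- Scott continuity in the argument: monomials are continuous, and monotone convergence exchanges
the supremum with the sum over `ν`. -/
theorem applyVec_iSup {I J : Type} (w : (I →₀ ℕ) × J → ℝ≥0∞) {u : ℕ → I → ℝ≥0∞}
    (hu : ∀ a, Monotone fun n => u n a) :
    applyVec w (fun a => ⨆ n, u n a) = fun b => ⨆ n, applyVec w (u n) b := by
  funext b
  simp only [applyVec, promVec_iSup hu, ENNReal.mul_iSup]
  exact tsum_iSup_of_monotone _ fun ν m n hmn =>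
    mul_le_mul_right (promVec_mono (fun a => hu a hmn) ν) _

theorem fixApprox_toFun_mono {I : Type} (w : (I →₀ ℕ) × I → ℝ≥0∞) (a : I) :
    Monotone fun n => (fixApprox I n).toFun w a :=
  fun _ _ hmn => ENNReal.tsum_le_tsum fun μ => mul_le_mul_left (fixApprox_mono I a μ hmn) _

/-- `Fix` yields a fixpoint. -/
theorem applyVec_toFun_fixMat {I : Type} (w : (I →₀ ℕ) × I → ℝ≥0∞) :
    applyVec w ((fixMat I).toFun w) = (fixMat I).toFun w := by
  rw [toFun_fixMat, applyVec_iSup w (fixApprox_toFun_mono w)]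
  funext a
  -- Kleene's argument: applying `w` shifts the chain of approximants by one, which leaves the
  -- supremum of an increasing chain unchanged.
  simp only [← toFun_fixApprox_succ]
  exact Monotone.iSup_nat_add (fixApprox_toFun_mono w a) 1

/-! ## Functions of terms -/

section

variable {Γ Δ : Ctx} {σ τ : Ty}

/-- This and the following computations recover the inductive clauses for `f_M` from the power
series that define the interpretation; `Sum.elim u v` is the environment `u` extended by a value for
the last variable. -/
theorem toFun_num (n : ℕ) (u : CtxWeb Γ → ℝ≥0∞) :
    (Term.num n : Term Γ Ty.nat).mat.toFun u = numVec n :=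
  funext fun k => value_C u (numVec n k)

theorem toFun_var (x : Var Γ σ) (u : CtxWeb Γ → ℝ≥0∞) :
    (Term.var x).mat.toFun u = fun a => u (x.inj a) :=
  funext fun a => value_X u (x.inj a)

theorem toFun_succ (M : Term Γ Ty.nat) (u : CtxWeb Γ → ℝ≥0∞) :
    (Term.succ M).mat.toFun u = fun c => ∑' b, sucMat (b, c) * M.mat.toFun u b :=
  Mat.toFun_linComp sucMat M.mat u

theorem toFun_ifz (M : Term Γ Ty.nat) (P : Term Γ σ) (R : Term (Ty.nat :: Γ) σ)
    (u : CtxWeb Γ → ℝ≥0∞) :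
    (Term.ifz M P R).mat.toFun u = fun b => M.mat.toFun u 0 * P.mat.toFun u b
      + ∑' n, M.mat.toFun u (n + 1) * R.mat.toFun (Sum.elim u (numVec n)) b := by
  have h : (Term.ifz M P R).mat.toFun u = _ := Mat.toFun_cond M.mat P.mat (Mat.curry R.mat) u
  simp only [Mat.applyVec_toFun_curry] at h
  exact h

theorem applyVec_toFun_lam (M : Term (σ :: Γ) τ) (u : CtxWeb Γ → ℝ≥0∞) (v : σ.Web → ℝ≥0∞) :
    applyVec ((Term.lam M).mat.toFun u) v = M.mat.toFun (Sum.elim u v) :=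
  Mat.applyVec_toFun_curry M.mat u v

theorem toFun_app (M : Term Γ (Ty.arrow σ τ)) (N : Term Γ σ) (u : CtxWeb Γ → ℝ≥0∞) :
    (Term.app M N).mat.toFun u = applyVec (M.mat.toFun u) (N.mat.toFun u) :=
  Mat.toFun_app M.mat N.mat u

theorem toFun_dice (p : Set.Icc (0 : ℚ) 1) (u : CtxWeb Γ → ℝ≥0∞) :
    (Term.dice p : Term Γ Ty.nat).mat.toFun u
      = fun k => ENNReal.ofReal ((p : ℚ) : ℝ) * numVec 0 k
        + ENNReal.ofReal (1 - ((p : ℚ) : ℝ)) * numVec 1 k :=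
  funext fun _ => value_C u _

theorem toFun_fix (M : Term Γ (Ty.arrow σ σ)) (u : CtxWeb Γ → ℝ≥0∞) :
    (Term.fix M).mat.toFun u = (fixMat _).toFun (M.mat.toFun u) :=
  Mat.toFun_comp (fixMat _) M.mat u

theorem toFun_fix_unfold (M : Term Γ (Ty.arrow σ σ)) (u : CtxWeb Γ → ℝ≥0∞) :
    (Term.fix M).mat.toFun u = (Term.app M (Term.fix M)).mat.toFun u := by
  rw [toFun_app, toFun_fix]
  exact (applyVec_toFun_fixMat _).symm

/-- Abstractions whose bodies have the same function have the same value. -/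
theorem Term.lam_toFun_ext {M : Term (σ :: Γ) τ} {M' : Term (σ :: Δ) τ} {u : CtxWeb Γ → ℝ≥0∞}
    {v : CtxWeb Δ → ℝ≥0∞} (hu : u ∈ (ctxSem Γ).P)
    (h : ∀ w ∈ σ.sem.P, M.mat.toFun (Sum.elim u w) = M'.mat.toFun (Sum.elim v w)) :
    (Term.lam M).mat.toFun u = (Term.lam M').mat.toFun v := by
  -- The values are matrices, while `h` compares their functions on `P⟦σ⟧` only; extensionality
  -- closes the gap.
  refine PCS.impl_ext (X := σ.sem) (Y := τ.sem) ((Term.lam M).toFun_mat_mem u hu) fun w hw => ?_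
  rw [applyVec_toFun_lam, applyVec_toFun_lam]
  exact h w hw

/-! ### Renaming and substitution -/

/-- The two environments are linked by a pointwise relation, which extends under a binder when both
receive the same value. Membership of `u` in `P⟦Δ⟧` serves the abstraction case, which goes through
extensionality. -/
theorem toFun_rename {Γ : Ctx} {σ : Ty} (M : Term Γ σ) : ∀ {Δ : Ctx} (ρ : Ren Γ Δ)
    (u : CtxWeb Δ → ℝ≥0∞) (v : CtxWeb Γ → ℝ≥0∞), u ∈ (ctxSem Δ).P →
    (∀ (τ : Ty) (x : Var Γ τ) (a : τ.Web), v (x.inj a) = u ((ρ τ x).inj a)) →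
    (M.rename ρ).mat.toFun u = M.mat.toFun v := by
  have lift : ∀ {Γ Δ : Ctx} (ρ : Ren Γ Δ) (σ : Ty) (u : CtxWeb Δ → ℝ≥0∞) (v : CtxWeb Γ → ℝ≥0∞)
      (w : σ.Web → ℝ≥0∞),
      (∀ (τ : Ty) (x : Var Γ τ) (a : τ.Web), v (x.inj a) = u ((ρ τ x).inj a)) →
      ∀ (τ : Ty) (x : Var (σ :: Γ) τ) (a : τ.Web), (Sum.elim v w : CtxWeb (σ :: Γ) → ℝ≥0∞) (x.inj a)
        = (Sum.elim u w : CtxWeb (σ :: Δ) → ℝ≥0∞) ((ρ.lift σ τ x).inj a) := by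
    intro Γ Δ ρ σ u v w h τ x a
    cases x with
    | zero => rfl
    | succ x => exact h τ x a
  induction M with
  | num n => intros; rw [Term.rename, toFun_num, toFun_num]
  | var x =>
    intro Δ ρ u v hu h
    rw [Term.rename, toFun_var, toFun_var]
    exact funext fun a => (h _ x a).symm
  | succ M ih =>
    intro Δ ρ u v hu h
    rw [Term.rename, toFun_succ, toFun_succ, ih ρ u v hu h]
  | ifz M P R ihM ihP ihR =>
    intro Δ ρ u v hu h
    rw [Term.rename, toFun_ifz, toFun_ifz, ihM ρ u v hu h, ihP ρ u v hu h]
    funext b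
    congr 1
    refine tsum_congr fun n => ?_
    have hn : numVec n ∈ Ty.nat.sem.P := numVec_mem n
    rw [ihR (ρ.lift _) _ _ ⟨hu, hn⟩ (lift ρ _ u v (numVec n) h)]
  | lam M ih =>
    intro Δ ρ u v hu h
    rw [Term.rename]
    exact Term.lam_toFun_ext hu fun w hw => ih (ρ.lift _) _ _ ⟨hu, hw⟩ (lift ρ _ u v w h)
  | app M N ihM ihN =>
    intro Δ ρ u v hu h
    rw [Term.rename, toFun_app, toFun_app, ihM ρ u v hu h, ihN ρ u v hu h]
  | dice p => intros; rw [Term.rename, toFun_dice, toFun_dice]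
  | fix M ih =>
    intro Δ ρ u v hu h
    rw [Term.rename, toFun_fix, toFun_fix, ih ρ u v hu h]

theorem toFun_weaken (M : Term Γ σ) {u : CtxWeb Γ → ℝ≥0∞} (hu : u ∈ (ctxSem Γ).P)
    {w : τ.Web → ℝ≥0∞} (hw : w ∈ τ.sem.P) :
    (M.weaken τ).mat.toFun (Sum.elim u w : CtxWeb (τ :: Γ) → ℝ≥0∞) = M.mat.toFun u :=
  toFun_rename M _ _ _ ⟨hu, hw⟩ fun _ _ _ => rfl

/-- The substitution lemma. -/
theorem toFun_subst {Γ : Ctx} {σ : Ty} (M : Term Γ σ) : ∀ {Δ : Ctx} (θ : Sub Γ Δ)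
    (u : CtxWeb Δ → ℝ≥0∞) (v : CtxWeb Γ → ℝ≥0∞), u ∈ (ctxSem Δ).P →
    (∀ (τ : Ty) (x : Var Γ τ) (a : τ.Web), v (x.inj a) = (θ τ x).mat.toFun u a) →
    (M.subst θ).mat.toFun u = M.mat.toFun v := by
  -- Older variables are sent to weakened terms, whose values do not see `w`; this is
  -- `toFun_weaken`, hence the membership assumptions on `u` and `w`.
  have lift : ∀ {Γ Δ : Ctx} (θ : Sub Γ Δ) (σ : Ty) (u : CtxWeb Δ → ℝ≥0∞) (v : CtxWeb Γ → ℝ≥0∞)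
      (w : σ.Web → ℝ≥0∞), u ∈ (ctxSem Δ).P → w ∈ σ.sem.P →
      (∀ (τ : Ty) (x : Var Γ τ) (a : τ.Web), v (x.inj a) = (θ τ x).mat.toFun u a) →
      ∀ (τ : Ty) (x : Var (σ :: Γ) τ) (a : τ.Web), (Sum.elim v w : CtxWeb (σ :: Γ) → ℝ≥0∞) (x.inj a)
        = (θ.lift σ τ x).mat.toFun (Sum.elim u w : CtxWeb (σ :: Δ) → ℝ≥0∞) a := by
    intro Γ Δ θ σ u v w hu hw h τ x a
    cases x with
    | zero =>
      have e := toFun_var (Var.zero : Var (σ :: Δ) σ) (Sum.elim u w : CtxWeb (σ :: Δ) → ℝ≥0∞)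
      exact (congrFun e a).symm
    | succ x =>
      have e := toFun_weaken (θ τ x) hu hw
      exact (h τ x a).trans (congrFun e a).symm
  induction M with
  | num n => intros; rw [Term.subst, toFun_num, toFun_num]
  | var x =>
    intro Δ θ u v hu h
    rw [Term.subst, toFun_var]
    exact funext fun a => (h _ x a).symm
  | succ M ih =>
    intro Δ θ u v hu h
    rw [Term.subst, toFun_succ, toFun_succ, ih θ u v hu h]
  | ifz M P R ihM ihP ihR =>
    intro Δ θ u v hu h
    rw [Term.subst, toFun_ifz, toFun_ifz, ihM θ u v hu h, ihP θ u v hu h]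
    funext b
    congr 1
    refine tsum_congr fun n => ?_
    have hn : numVec n ∈ Ty.nat.sem.P := numVec_mem n
    rw [ihR (θ.lift _) _ _ ⟨hu, hn⟩ (lift θ _ u v (numVec n) hu hn h)]
  | lam M ih =>
    intro Δ θ u v hu h
    rw [Term.subst]
    exact Term.lam_toFun_ext hu fun w hw =>
      ih (θ.lift _) _ _ ⟨hu, hw⟩ (lift θ _ u v w hu hw h)
  | app M N ihM ihN =>
    intro Δ θ u v hu h
    rw [Term.subst, toFun_app, toFun_app, ihM θ u v hu h, ihN θ u v hu h]
  | dice p => intros; rw [Term.subst, toFun_dice, toFun_dice]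
  | fix M ih =>
    intro Δ θ u v hu h
    rw [Term.subst, toFun_fix, toFun_fix, ih θ u v hu h]

theorem toFun_subst1 (M : Term (σ :: Γ) τ) (N : Term Γ σ) {u : CtxWeb Γ → ℝ≥0∞}
    (hu : u ∈ (ctxSem Γ).P) :
    (M.subst1 N).mat.toFun u = M.mat.toFun (Sum.elim u (N.mat.toFun u)) := by
  refine toFun_subst M (Sub.single N) u _ hu fun τ x a => ?_
  cases x with
  | zero => rfl
  | succ x => exact (congrFun (toFun_var x u) a).symm

/-! ## Invariance of the interpretation under reduction -/

theorem toFun_succ_num (n : ℕ) (u : CtxWeb Γ → ℝ≥0∞) :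
    (Term.succ (Term.num n) : Term Γ Ty.nat).mat.toFun u = numVec (n + 1) := by
  rw [toFun_succ, toFun_num]
  funext c
  rw [tsum_eq_single n (fun b hb => by simp [numVec, hb])]
  simp [sucMat, numVec]

/-- Beta combines currying with the substitution lemma, `fix` is the fixpoint equation, and in a
conditional on a numeral the vector `numVec` selects a single branch. -/
theorem DStep.toFun_eq {M M' : Term Γ σ} (h : DStep M M') {u : CtxWeb Γ → ℝ≥0∞}
    (hu : u ∈ (ctxSem Γ).P) : M.mat.toFun u = M'.mat.toFun u := by
  cases h with
  | beta M N => rw [toFun_app, applyVec_toFun_lam, toFun_subst1 M N hu]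
  | fix M => exact toFun_fix_unfold M u
  | succ n => rw [toFun_succ_num, toFun_num]
  | ifzZero P R =>
    rw [toFun_ifz, toFun_num]
    simp [numVec]
  | ifzSucc n P R =>
    rw [toFun_ifz, toFun_num, toFun_subst1 R (.num n) hu, toFun_num]
    funext b
    rw [tsum_eq_single n (fun k hk => by simp [numVec, hk])]
    simp [numVec]

/-- In a redex the active subterm is already an abstraction or a numeral, neither of which reduces,
so no contextual rule competes with the root rule. -/
theorem DStep.eq_of_step {M N N' : Term Γ σ} {q : ℝ} (h : DStep M N) (h' : Step M q N') :
    N' = N := by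
  cases h with
  | beta M N =>
    cases h' with
    | det h => cases h; rfl
    | app _ h => cases h with | det h => cases h
  | fix M =>
    cases h' with
    | det h => cases h; rfl
  | succ n =>
    cases h' with
    | det h => cases h; rfl
    | succ h => cases h with | det h => cases h
  | ifzZero P R =>
    cases h' with
    | det h => cases h; rfl
    | ifz _ _ h => cases h with | det h => cases h
  | ifzSucc n P R =>
    cases h' with
    | det h => cases h; rfl
    | ifz _ _ h => cases h with | det h => cases h

/-! ### Rows of the reduction matrix -/

theorem redMat_of_step {M M' : Term Γ σ} {p : ℝ} (h : Step M p M') :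
    redMat M M' = ENNReal.ofReal p := by
  have hex : ∃ p : ℝ, Step M p M' := ⟨p, h⟩
  -- The probability chosen in `redMat` is `p`, by uniqueness.
  rw [redMat, dif_pos hex, hex.choose_spec.prob_unique h]

theorem redMat_of_weakNormal {M : Term Γ σ} (h : WeakNormal M) : redMat M M = 1 := by
  have hex : ¬ ∃ p : ℝ, Step M p M := fun ⟨p, hp⟩ => h p M hp
  rw [redMat, dif_neg hex, if_pos ⟨h, rfl⟩]

theorem redMat_of_weakNormal_of_ne {M M' : Term Γ σ} (h : WeakNormal M) (hne : M' ≠ M) :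
    redMat M M' = 0 := by
  have hex : ¬ ∃ p : ℝ, Step M p M' := fun ⟨p, hp⟩ => h p M' hp
  rw [redMat, dif_neg hex, if_neg fun hc => hne hc.2]

/-- The step to `K`, even if its probability is `0`, excludes the weak-normal diagonal entry. -/
theorem redMat_eq_zero {M M' K : Term Γ σ} {p : ℝ} (h : Step M p K) (h' : ∀ q, ¬ Step M q M') :
    redMat M M' = 0 := by
  have hex : ¬ ∃ p : ℝ, Step M p M' := fun ⟨q, hq⟩ => h' q hq
  rw [redMat, dif_neg hex, if_neg fun hc => hc.1 p K h]

/-- If the reductions of `C M` are those of `M` in the context `C`, then the row of `C M` in the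
reduction matrix is the image of the row of `M`. -/
theorem tsum_redMat_context {C : Term Γ σ → Term Δ τ} (hC : Function.Injective C)
    {M M' : Term Γ σ} {p : ℝ} (h : Step M p M') (hstep : ∀ {q N}, Step M q N → Step (C M) q (C N))
    (hinv : ∀ {q K}, Step (C M) q K → ∃ N, K = C N ∧ Step M q N) (g : Term Δ τ → ℝ≥0∞) :
    ∑' K, redMat (C M) K * g K = ∑' N, redMat M N * g (C N) := by
  -- Reindexing along `C` loses nothing: as `M` reduces, the row of `C M` is supported in the range
  -- of `C`.
  rw [← hC.tsum_eq (f := fun K => redMat (C M) K * g K)]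
  · refine tsum_congr fun N => ?_
    congr 1
    by_cases hN : ∃ q, Step M q N
    · obtain ⟨q, hq⟩ := hN
      rw [redMat_of_step hq, redMat_of_step (hstep hq)]
    · rw [redMat_eq_zero h fun q hq => hN ⟨q, hq⟩, redMat_eq_zero (hstep h)]
      intro q hq
      obtain ⟨N', e, hN'⟩ := hinv hq
      exact hN ⟨q, hC e ▸ hN'⟩
  · intro K hK
    by_contra hr
    refine hK ?_
    dsimp only
    rw [redMat_eq_zero (hstep h), zero_mul]
    intro q hq
    obtain ⟨N, e, -⟩ := hinv hq
    exact hr ⟨N, e.symm⟩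

/-- Since `M` reduces it is not an abstraction, so the application is not itself a redex. The
inversions for `succ` and `ifz` rest likewise on numerals being irreducible. -/
theorem Step.app_inv {M M' : Term Γ (Ty.arrow σ τ)} {p : ℝ} (h : Step M p M') {N : Term Γ σ}
    {q : ℝ} {K : Term Γ τ} (hK : Step (.app M N) q K) : ∃ L, K = .app L N ∧ Step M q L := by
  cases hK with
  | det hd =>
    cases hd with
    | beta => cases h with | det h => cases h
  | app _ h => exact ⟨_, rfl, h⟩

theorem Step.succ_inv {M M' : Term Γ Ty.nat} {p : ℝ} (h : Step M p M') {q : ℝ}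
    {K : Term Γ Ty.nat} (hK : Step (.succ M) q K) : ∃ L, K = .succ L ∧ Step M q L := by
  cases hK with
  | det hd =>
    cases hd with
    | succ => cases h with | det h => cases h
  | succ h => exact ⟨_, rfl, h⟩

theorem Step.ifz_inv {M M' : Term Γ Ty.nat} {p : ℝ} (h : Step M p M') {P : Term Γ σ}
    {R : Term (Ty.nat :: Γ) σ} {q : ℝ} {K : Term Γ σ} (hK : Step (.ifz M P R) q K) :
    ∃ L, K = .ifz L P R ∧ Step M q L := by
  cases hK with
  | det hd =>
    cases hd with
    | ifzZero => cases h with | det h => cases h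
    | ifzSucc => cases h with | det h => cases h
  | ifz _ _ h => exact ⟨_, rfl, h⟩

/-- The conclusion concerns the whole row of `M`; the given step only witnesses that `M` is not
weak-normal and provides the induction. In the contextual cases, linearity in the reduced subterm
lets the induction hypothesis be inserted and the sums exchanged. -/
theorem toFun_eq_tsum_of_step {M M' : Term Γ σ} {p : ℝ} (h : Step M p M') {u : CtxWeb Γ → ℝ≥0∞}
    (hu : u ∈ (ctxSem Γ).P) :
    ∀ b, M.mat.toFun u b = ∑' N, redMat M N * N.mat.toFun u b := by
  induction h with
  | @det σ M M' h =>
    intro b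
    have hs : Step M 1 M' := .det h
    rw [tsum_eq_single M', redMat_of_step hs, ENNReal.ofReal_one, one_mul, h.toFun_eq hu]
    intro N hN
    rw [redMat_eq_zero hs fun q hq => hN (h.eq_of_step hq), zero_mul]
  -- Both rules concern the same row, whose only possibly nonzero entries are at the numerals `0`
  -- and `1`.
  | @diceZero p | @diceOne p =>
    intro b
    classical
    have h0 := Step.diceZero (Γ := Γ) p
    have h1 := Step.diceOne (Γ := Γ) p
    rw [tsum_eq_sum (s := {Term.num 0, Term.num 1}), Finset.sum_pair (by simp),
      redMat_of_step h0, redMat_of_step h1, toFun_dice, toFun_num, toFun_num]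
    intro N hN
    rw [redMat_eq_zero h0, zero_mul]
    intro q hq
    apply hN
    cases hq with
    | det h => cases h
    | diceZero => simp
    | diceOne => simp
  | @app σ τ M M' p N h ih =>
    intro b
    rw [tsum_redMat_context (C := fun M => Term.app M N) (fun _ _ e => by cases e; rfl) h
      (fun h => .app N h) h.app_inv]
    -- Application is linear in the function: its value is a sum over `ν` of entries of that matrix
    -- times monomials in the argument.
    simp only [toFun_app, applyVec, ← ENNReal.tsum_mul_left]
    rw [ENNReal.tsum_comm]
    refine tsum_congr fun ν => ?_
    rw [ih, ← ENNReal.tsum_mul_right]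
    exact tsum_congr fun _ => mul_assoc _ _ _
  | @succ M M' p h ih =>
    intro b
    rw [tsum_redMat_context (C := Term.succ) (fun _ _ e => by cases e; rfl) h
      (fun h => .succ h) h.succ_inv]
    have e : ∀ N : Term Γ Ty.nat, N.succ.mat.toFun u b
        = ∑' n : ℕ, sucMat (n, b) * N.mat.toFun u n := fun N => congrFun (toFun_succ N u) b
    simp only [e, ← ENNReal.tsum_mul_left]
    rw [ENNReal.tsum_comm]
    refine tsum_congr fun n => ?_
    rw [ih, ← ENNReal.tsum_mul_left]
    exact tsum_congr fun _ => mul_left_comm _ _ _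
  | @ifz σ M M' p P R h ih =>
    intro b
    rw [tsum_redMat_context (C := fun M => Term.ifz M P R) (fun _ _ e => by cases e; rfl) h
      (fun h => .ifz P R h) h.ifz_inv]
    simp only [toFun_ifz, mul_add, ENNReal.tsum_add, ← ENNReal.tsum_mul_left, ← mul_assoc]
    congr 1
    · rw [ih, ENNReal.tsum_mul_right]
    · rw [ENNReal.tsum_comm]
      refine tsum_congr fun n => ?_
      rw [ih, ENNReal.tsum_mul_right]

theorem toFun_eq_tsum (M : Term Γ σ) {u : CtxWeb Γ → ℝ≥0∞} (hu : u ∈ (ctxSem Γ).P)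
    (b : σ.Web) : M.mat.toFun u b = ∑' N, redMat M N * N.mat.toFun u b := by
  by_cases h : WeakNormal M
  · rw [tsum_eq_single M, redMat_of_weakNormal h, one_mul]
    intro N hN
    rw [redMat_of_weakNormal_of_ne h hN, zero_mul]
  · simp only [WeakNormal, not_forall, not_not] at h
    obtain ⟨p, M', h⟩ := h
    exact toFun_eq_tsum_of_step h hu b

/-- The interpretation is invariant under reduction. -/
theorem sem_eq_tsum (M : Term Γ σ) (x : (CtxWeb Γ →₀ ℕ) × σ.Web) :
    M.sem.1 x = ∑' N, redMat M N * N.sem.1 x := by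
  obtain ⟨μ, b⟩ := x
  -- For fixed `b` the right-hand side is itself a power series in the environment, so equality of
  -- values gives equality of coefficients. Finiteness is needed on the left only.
  have e := (ctxSem Γ).eq_of_value_eq (s := M.mat b)
    (t := fun μ => ∑' N : Term Γ σ, redMat M N * MvPowerSeries.coeff μ (N.mat b))
    (fun u hu => (σ.sem.lt_top (M.toFun_mat_mem u hu) b).ne) fun u hu => by
      refine (toFun_eq_tsum M hu b).trans ?_
      simp only [Mat.toFun, value, ← ENNReal.tsum_mul_left]
      rw [ENNReal.tsum_comm]
      refine tsum_congr fun ν => ?_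
      simp only [← mul_assoc]
      exact ENNReal.tsum_mul_right
  exact congrFun e μ

/-! ### Powers of the reduction matrix -/

/-- The family of interpretations is a fixed vector of `redMat` by `sem_eq_tsum`, hence of all its
powers, by associativity of the matrix action. -/
theorem closedSem_eq_tsum_matPow (M : Term [] σ) (k : ℕ) (b : σ.Web) :
    M.closedSem b = ∑' N, matPow redMat k M N * N.closedSem b := by
  induction k with
  | zero =>
    rw [tsum_eq_single M]
    · simp [matPow]
    · intro N hN
      simp [matPow, hN.symm]
  | succ k ih =>
    rw [ih]
    simp only [matPow, matMul, ← ENNReal.tsum_mul_right]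
    rw [ENNReal.tsum_comm]
    refine tsum_congr fun N => ?_
    simp only [mul_assoc]
    rw [ENNReal.tsum_mul_left]
    exact congrArg (matPow redMat k M N * ·) (sem_eq_tsum N (0, b))

theorem closedSem_num (n : ℕ) : (Term.num n : Term [] Ty.nat).closedSem n = 1 := by
  classical
  change MvPowerSeries.coeff 0 (MvPowerSeries.C (numVec n n)) = 1
  simp [numVec]

end

end PPCF
theorem mainTheorem5 :
    (∀ (Γ : PPCF.Ctx) (σ : PPCF.Ty) (M : PPCF.Term Γ σ),
      M.sem.1 = fun x => ∑' M' : PPCF.Term Γ σ, PPCF.redMat M M' * M'.sem.1 x) ∧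
    (∀ (M : PPCF.Term [] PPCF.Ty.nat) (n : ℕ),
      PPCF.matLim PPCF.redMat M (PPCF.Term.num n) ≤ M.closedSem n) := by
  refine ⟨fun Γ σ M => funext fun x => PPCF.sem_eq_tsum M x, fun M n => ?_⟩
  rw [PPCF.matLim]
  split_ifs
  · refine iSup_le fun k => ?_
    rw [PPCF.closedSem_eq_tsum_matPow M k n]
    -- All summands are nonnegative, so the one at `num n` alone is a lower bound; its second factor
    -- is `1`.
    refine le_trans ?_ (ENNReal.le_tsum (PPCF.Term.num n))
    rw [PPCF.closedSem_num, mul_one]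
  · exact zero_le
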